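/- Let $n\ge 1$ and identify $\mathbb{H}^n$ with $\mathbb{R}^{4n}$ by $q_l=x_{4l}+\mathbf{i}x_{4l+1}+\mathbf{j}x_{4l+2}+\mathbf{k}x_{4l+3}$, $0\le l\le n-1$, with the Euclidean norm $\|q\|$ and Lebesgue measure $dV$. An upper semicontinuous function $u:\mathbb{H}^n\to[-\infty,\infty)$ is plurisubharmonic (PSH) if it is subharmonic on each right quaternionic line $\{a+bt: t\in\mathbb{H}\}$, $a,b\in\mathbb{H}^n$, $b\neq0$; that is, on each such line its value at the center of a $3$-sphere is at most its average over that sphere. Put $$\begin{pmatrix}\nabla_{(2l)0}&\nabla_{(2l)1}\\ \nabla_{(2l+1)0}&\nabla_{(2l+1)1}\end{pmatrix}=\begin{pmatrix}\partial_{x_{4l}}+\mathbf{i}\partial_{x_{4l+1}}&-\partial_{x_{4l+2}}-\mathbf{i}\partial_{x_{4l+3}}\\ \partial_{x_{4l+2}}-\mathbf{i}\partial_{x_{4l+3}}&\partial_{x_{4l}}-\mathbf{i}\partial_{x_{4l+1}}\end{pmatrix},$$ let $\omega^0,\ldots,\omega^{2n-1}$ be a basis of $\mathbb{C}^{2n}$,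 and for a form $F=\sum_I f_I\,\omega^I$ with values in $\wedge^{\bullet}\mathbb{C}^{2n}$ let $d_\alpha F=\sum_{k,I}\nabla_{k\alpha}f_I\,\omega^k\wedge\omega^I$ ($\alpha=0,1$) and $\triangle F=d_0d_1F$. A current of order zero is $T=\sum_I T_I\,\omega^I$ with complex Radon measures $T_I$ on $\mathbb{H}^n$; it acts on smooth compactly supported forms $\eta$ of complementary degree by integrating the coefficient of $\omega^0\wedge\cdots\wedge\omega^{2n-1}$ in $T\wedge\eta$. If $u$ is locally integrable with respect to all the $T_I$, put $uT=\sum_I (uT_I)\,\omega^I$ and $\triangle u\wedge T:=\triangle(uT)$, i.e. $(\triangle u\wedge T)(\eta):=(uT)(\triangle\eta)$. Set $(\triangle u)^0=1$ and inductively $(\triangle u)^{k+1}=\triangle u\wedge(\triangle u)^k$, whenever $u$ is locally integrable with respect to the coefficients of $(\triangle u)^k$ and the result is again a current of order zero. A Radon measure $\mu$ is the Monge–Ampère measure of $u$ if $(\triangle u)^n$ is defined in this way and $(\triangle u)^n=\mu\;\omega^0\wedge\cdots\wedge\omega^{2n-1}$; one then writes $(\triangle u)^n=\mu$. Proposition.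 The function $q\mapsto-\dfrac{1}{\|q\|^2}$, with value $-\infty$ at $q=0$, is PSH on $\mathbb{H}^n$. Its Monge–Ampère measure is defined, unique, and equal to $$\left(\triangle\Big(-\frac{1}{\|q\|^2}\Big)\right)^n=\frac{8^n\,n!\,\pi^{2n}}{(2n)!}\,\delta_0,$$ where $\delta_0$ is the unit point mass at the origin. -/

import Mathlib

open scoped Quaternion

noncomputable section

namespace QuaternionicMA

open MeasureTheory

/-! ### Quaternionic space and plurisubharmonic functions -/

/-- `ℍⁿ`, identified with `ℝ⁴ⁿ` (Euclidean norm, Lebesgue measure): the real coordinates of the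
`l`-th quaternionic coordinate are
`q_l = x (l, 0) + i x (l, 1) + j x (l, 2) + k x (l, 3)`. -/
abbrev QSpace (n : ℕ) : Type := EuclideanSpace ℝ (Fin n × Fin 4)

/-- The point of `ℍⁿ` with the given quaternionic coordinates. -/
def ofQuat {n : ℕ} (q : Fin n → ℍ[ℝ]) : QSpace n :=
  WithLp.toLp 2 fun p => Quaternion.linearIsometryEquivTuple (q p.1) p.2

/-- The uniform probability measure on the unit sphere of `ℝ⁴ ≅ ℍ`. -/
def sphereMeasure : Measure (Metric.sphere (0 : EuclideanSpace ℝ (Fin 4)) 1) :=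
  ((volume : Measure (EuclideanSpace ℝ (Fin 4))).toSphere Set.univ)⁻¹ •
    (volume : Measure (EuclideanSpace ℝ (Fin 4))).toSphere

/-- The average of `v` over the sphere of centre `c` and radius `r` in `ℍ`, as the integral of the
positive part minus the integral of the negative part. (For an upper semicontinuous `v < +∞` the
former is finite, so that the difference is meaningful; it may be `-∞`.) -/
def sphereMean (v : ℍ[ℝ] → EReal) (c : ℍ[ℝ]) (r : ℝ) : EReal :=
  ((∫⁻ ω, (v (c + r • Quaternion.linearIsometryEquivTuple.symm ω.1)).toENNReal
      ∂sphereMeasure : ENNReal) : EReal) -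
  ((∫⁻ ω, (-v (c + r • Quaternion.linearIsometryEquivTuple.symm ω.1)).toENNReal
      ∂sphereMeasure : ENNReal) : EReal)

/-- Subharmonic functions `ℍ → [-∞, ∞)`, where `ℍ ≅ ℝ⁴`. -/
def IsSubharmonic (v : ℍ[ℝ] → EReal) : Prop :=
  UpperSemicontinuous v ∧ (∀ c, v c ≠ ⊤) ∧ ∀ (c : ℍ[ℝ]) (r : ℝ), 0 < r → v c ≤ sphereMean v c r

/-- `u : ℍⁿ → [-∞, ∞)` is plurisubharmonic: it is upper semicontinuous, and subharmonic on each
right quaternionic line `{a + b t : t ∈ ℍ}`, `b ≠ 0`. -/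
def IsPSH {n : ℕ} (u : QSpace n → EReal) : Prop :=
  UpperSemicontinuous u ∧ (∀ q, u q ≠ ⊤) ∧
    ∀ a b : Fin n → ℍ[ℝ], b ≠ 0 → IsSubharmonic fun t => u (ofQuat fun l => a l + b l * t)

/-! ### Forms and the operators `d₀`, `d₁`, `△` -/

/-- The real partial derivative `∂ / ∂x (l, a)` of a complex valued function. -/
def pderiv {n : ℕ} (l : Fin n) (a : Fin 4) (f : QSpace n → ℂ) (q : QSpace n) : ℂ :=
  fderiv ℝ f q (EuclideanSpace.single (l, a) 1)

/-- The operators `∇_{jα}`, `0 ≤ j < 2n`, `α = 0, 1`. Here `j = 2l + s` with `l = j.divNat` and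
`s = j.modNat`, and for fixed `l` the matrix `(∇_{(2l+s)α})` has rows `s = 0, 1` and columns
`α = 0, 1`. -/
def nabla {n : ℕ} (j : Fin (n * 2)) (α : Fin 2) (f : QSpace n → ℂ) (q : QSpace n) : ℂ :=
  let D : Fin 4 → ℂ := fun a => pderiv j.divNat a f q
  !![D 0 + Complex.I * D 1, -D 2 - Complex.I * D 3;
     D 2 - Complex.I * D 3, D 0 - Complex.I * D 1] j.modNat α

/-- Functions on `ℍⁿ` with values in the exterior algebra of `ℂ²ⁿ`, given by their coefficients:
`F` stands for `∑_I F I ω^I`, where `I` runs over the subsets of `{0, …, 2n-1}` and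
`ω^I = ω^{i₁} ∧ … ∧ ω^{i_p}` if `I = {i₁ < … < i_p}`. -/
abbrev Form (n : ℕ) : Type := Finset (Fin (n * 2)) → QSpace n → ℂ

/-- `d_α F = ∑_{k, I} ∇_{kα} F_I ω^k ∧ ω^I`. The coefficient at `ω^K` collects the pairs with
`K = {k} ∪ I`, `k ∉ I`, for which `ω^k ∧ ω^I = (-1)^{#{i ∈ I : i < k}} ω^K`. -/
def d {n : ℕ} (α : Fin 2) (F : Form n) : Form n := fun K q =>
  ∑ k ∈ K, (-1 : ℂ) ^ (K.filter (· < k)).card * nabla k α (F (K.erase k)) q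

/-- The Baston operator `△ = d₀ d₁`. -/
def baston {n : ℕ} (F : Form n) : Form n := d 0 (d 1 F)

/-- Test forms: all coefficients are smooth with compact support. -/
def IsTestForm {n : ℕ} (η : Form n) : Prop :=
  ∀ I, ContDiff ℝ ((⊤ : ℕ∞) : WithTop ℕ∞) (η I) ∧ HasCompactSupport (η I)

/-! ### Currents of order zero and the Monge-Ampère measure -/

/-- The sign `ε_I` with `ε_I ω^I ∧ ω^{Iᶜ} = ω^0 ∧ ω^1 ∧ … ∧ ω^{2n-1}`. -/
def wedgeSign {n : ℕ} (I : Finset (Fin (n * 2))) : ℂ :=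
  (-1 : ℂ) ^ ((I ×ˢ Iᶜ).filter fun p => p.2 < p.1).card

/-- A current of order zero, `T = ∑_I T_I ω^I`, whose coefficients are the complex Radon measures
`T_I = coeff I • base`, with `base` a (positive) Radon measure and `coeff I` locally
integrable. -/
structure RadonCurrent (n : ℕ) where
  base : Measure (QSpace n)
  coeff : Form n
  locallyFinite : IsLocallyFiniteMeasure base
  locallyIntegrable : ∀ I, LocallyIntegrable (coeff I) base

/-- The value `∑_I ε_I ∫ η_{Iᶜ} c_I dm` at the form `η` of the current `∑_I (c_I m) ω^I`. -/
def pairing {n : ℕ} (m : Measure (QSpace n)) (c : Form n) (η : Form n) : ℂ :=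
  ∑ I, wedgeSign I * ∫ q, c I q * η Iᶜ q ∂m

/-- The value `T(η)` of the current `T` at the test form `η`. -/
def RadonCurrent.apply {n : ℕ} (T : RadonCurrent n) (η : Form n) : ℂ :=
  pairing T.base T.coeff η

/-- The function `u` is locally integrable with respect to all the coefficients of `T`; in
particular these do not charge the set where `u` is infinite. So the current
`u T = ∑_I (u T_I) ω^I` is defined and has order zero. This holds for every `T` if `u` is
a locally bounded Borel function. -/
def RadonCurrent.Integrates {n : ℕ} (T : RadonCurrent n) (u : QSpace n → EReal) : Prop :=
  ∀ I, (∀ᵐ q ∂T.base, u q = ⊥ ∨ u q = ⊤ → T.coeff I q = 0) ∧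
    LocallyIntegrable (fun q => ((u q).toReal : ℂ) * T.coeff I q) T.base

/-- The value `(u T)(η)` of the current `u T` at the test form `η`. -/
def RadonCurrent.mulApply {n : ℕ} (u : QSpace n → EReal) (T : RadonCurrent n) (η : Form n) : ℂ :=
  pairing T.base (fun I q => ((u q).toReal : ℂ) * T.coeff I q) η

/-- `S = △u ∧ T`, where `△u ∧ T := △(uT)`, that is, `(△u ∧ T)(η) = (uT)(△η)` for all test
forms `η`; it is part of the assertion that `uT` is defined. -/
def IsBastonWedge {n : ℕ} (u : QSpace n → EReal) (T S : RadonCurrent n) : Prop :=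
  T.Integrates u ∧ ∀ η : Form n, IsTestForm η → S.apply η = T.mulApply u (baston η)

/-- `T = (△u)^k`: inductively `(△u)^0 = 1` and `(△u)^{k+1} = △u ∧ (△u)^k = △(u (△u)^k)`. -/
def IsBastonPower {n : ℕ} (u : QSpace n → EReal) : ℕ → RadonCurrent n → Prop
  | 0, T => ∀ η : Form n, IsTestForm η → T.apply η = ∫ q, η Finset.univ q
  | k + 1, S => ∃ T : RadonCurrent n, IsBastonPower u k T ∧ IsBastonWedge u T S

/-- `μ` is the Monge-Ampère measure of `u`: the Radon measure with
`(△u)^n = μ ω^0 ∧ ω^1 ∧ … ∧ ω^{2n-1}`. -/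
def IsMongeAmpereMeasure {n : ℕ} (u : QSpace n → EReal) (μ : Measure (QSpace n)) : Prop :=
  IsLocallyFiniteMeasure μ ∧ ∃ T : RadonCurrent n, IsBastonPower u n T ∧
    ∀ η : Form n, IsTestForm η → T.apply η = ∫ q, η ∅ q ∂μ

/-- The function `-1 / ‖q‖²` on `ℍⁿ`, with the value `-∞` at the origin. -/
def negInvNormSq (n : ℕ) (q : QSpace n) : EReal :=
  if q = 0 then ⊥ else ((-1 / ‖q‖ ^ 2 : ℝ) : EReal)

end QuaternionicMA

end

open scoped Quaternion

noncomputable section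

namespace QuaternionicMA

open MeasureTheory Filter Topology

/-! ### The exterior algebra in coordinates -/

/-! Regularise. Put s = (‖q‖² + ε)⁻¹, u_ε = -s, β = ∑ ω^{2l} ∧ ω^{2l+1} and g_α = d_α‖q‖²/2. Since
d_0 g_0 = 0 and d_0 g_1 = 4β = -d_1 g_0, all powers have a closed form, (△u_ε)^k = 8^k (s^{2k} β^k -
k s^{2k+1} g_0 ∧ g_1 ∧ β^{k-1}), which is `powVec`; the induction step is
`dVec_zero_regInv_smul_powVec` with `dVec_one_halfVec`. Integration by parts (`pairing_d`) gives the
weak identity `pairing_regularised`.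

For k < n the coefficients of (△u_ε)^k and u_ε(△u_ε)^k are O(‖q‖^{-4k}) and O(‖q‖^{-4k-2}) uniformly
in ε, hence dominated by locally integrable functions on ℝ^{4n}, and the identity survives ε → 0. In
degree n one has g_0 ∧ g_1 ∧ β^{n-1} = (n-1)! ‖q‖² ω^0 ∧ … ∧ ω^{2n-1}; the leading terms cancel and
leave 8^n n! ε s^{2n+1} (`powVec_top`), an approximate identity of mass 8^n n! ∫ (1+‖q‖²)^{-2n-1} =
8^n n! π^{2n}/(2n)!. Its limit is the point mass.

Uniqueness: the values of a current on test forms determine its coefficients, hence also its product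
with u (`RadonCurrent.mulApply_eq_of_apply_eq`), so the choice of the intermediate powers is
immaterial.

Plurisubharmonicity: on a sphere in a right line ‖q‖² equals P + Q + 2⟨e,ω⟩, where P is its value at
the centre and ‖e‖² ≤ PQ. This is κ‖e' + sω‖² with a unit vector e', now 0 ≤ s ≤ 1, and κ ≥ P. Since
‖x‖⁻² is harmonic on ℝ⁴ off the origin, the mean of the reciprocal is 1/κ ≤ 1/P
(`lintegral_sphere_inv_le`). -/

/-- Coefficients of an element of the exterior algebra of `ℂ²ⁿ`. -/
abbrev Coeffs (n : ℕ) : Type := Finset (Fin (n * 2)) → ℂ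

/-- Left multiplication by `ω^j` on the exterior algebra. -/
def wedgeLeft {n : ℕ} (j : Fin (n * 2)) : Module.End ℂ (Coeffs n) where
  toFun v K := if j ∈ K then (-1 : ℂ) ^ (K.filter (· < j)).card * v (K.erase j) else 0
  map_add' v w := by
    ext K
    by_cases h : j ∈ K <;> simp [h, mul_add]
  map_smul' c v := by
    ext K
    by_cases h : j ∈ K <;> simp [h, mul_left_comm]

lemma wedgeLeft_apply {n : ℕ} (j : Fin (n * 2)) (v : Coeffs n) (K : Finset (Fin (n * 2))) :
    wedgeLeft j v K =
      if j ∈ K then (-1 : ℂ) ^ (K.filter (· < j)).card * v (K.erase j) else 0 := rfl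

lemma sign_erase_of_lt {n : ℕ} {j k : Fin (n * 2)} (h : j < k) {K : Finset (Fin (n * 2))}
    (hj : j ∈ K) :
    (-1 : ℂ) ^ (K.filter (· < k)).card = -(-1 : ℂ) ^ ((K.erase j).filter (· < k)).card := by
  have : (K.filter (· < k)).card = ((K.erase j).filter (· < k)).card + 1 := by
    rw [Finset.filter_erase, Finset.card_erase_add_one (Finset.mem_filter.2 ⟨hj, h⟩)]
  rw [this, pow_succ]; ring

lemma sign_erase_of_le {n : ℕ} {j k : Fin (n * 2)} (h : k ≤ j) (K : Finset (Fin (n * 2))) :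
    (K.erase j).filter (· < k) = K.filter (· < k) := by
  ext i
  simp only [Finset.mem_filter, Finset.mem_erase]
  constructor
  · rintro ⟨⟨_, h1⟩, h2⟩; exact ⟨h1, h2⟩
  · rintro ⟨h1, h2⟩; exact ⟨⟨(h2.trans_le h).ne, h1⟩, h2⟩

/-- Deleting j < k lowers the number of indices below k by one, while deleting k leaves the count
below j alone; this one change of parity is the minus sign. -/
lemma wedgeLeft_mul_wedgeLeft_of_lt {n : ℕ} {j k : Fin (n * 2)} (h : j < k) :
    wedgeLeft j * wedgeLeft k = -(wedgeLeft k * wedgeLeft j : Module.End ℂ (Coeffs n)) := by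
  refine LinearMap.ext fun v => funext fun K => ?_
  simp only [Module.End.mul_apply, LinearMap.neg_apply, Pi.neg_apply, wedgeLeft_apply,
    Finset.mem_erase]
  by_cases hj : j ∈ K <;> by_cases hk : k ∈ K <;> simp [hj, hk, h.ne, h.ne']
  rw [sign_erase_of_le h.le, sign_erase_of_lt h hj, Finset.erase_right_comm]
  ring

lemma wedgeLeft_mul_self {n : ℕ} (j : Fin (n * 2)) :
    wedgeLeft j * wedgeLeft j = (0 : Module.End ℂ (Coeffs n)) := by
  refine LinearMap.ext fun v => funext fun K => ?_
  simp [Module.End.mul_apply, wedgeLeft_apply]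

lemma wedgeLeft_mul_add_mul {n : ℕ} (j k : Fin (n * 2)) :
    wedgeLeft j * wedgeLeft k + wedgeLeft k * wedgeLeft j = (0 : Module.End ℂ (Coeffs n)) := by
  rcases lt_trichotomy j k with h | rfl | h
  · rw [wedgeLeft_mul_wedgeLeft_of_lt h]; exact neg_add_cancel _
  · simp [wedgeLeft_mul_self]
  · rw [wedgeLeft_mul_wedgeLeft_of_lt h]; exact add_neg_cancel _

lemma wedgeLeft_anticomm {n : ℕ} (j k : Fin (n * 2)) :
    wedgeLeft j * wedgeLeft k = (-1 : ℂ) • (wedgeLeft k * wedgeLeft j : Module.End ℂ (Coeffs n)) := by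
  rw [eq_neg_of_add_eq_zero_left (wedgeLeft_mul_add_mul j k)]
  exact (neg_one_smul ℂ _).symm

lemma wedgeLeft_mul_mul {n : ℕ} (j k : Fin (n * 2)) (X : Module.End ℂ (Coeffs n)) :
    wedgeLeft j * (wedgeLeft k * X) = (-1 : ℂ) • (wedgeLeft k * (wedgeLeft j * X)) := by
  rw [← mul_assoc, wedgeLeft_anticomm, smul_mul_assoc, mul_assoc]

/-- The index `2l + s`. -/
abbrev idx {n : ℕ} (l : Fin n) (s : Fin 2) : Fin (n * 2) := finProdFinEquiv (l, s)

@[simp] lemma divNat_idx {n : ℕ} (l : Fin n) (s : Fin 2) : (idx l s).divNat = l :=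
  congrArg Prod.fst (finProdFinEquiv.symm_apply_apply (l, s))

@[simp] lemma modNat_idx {n : ℕ} (l : Fin n) (s : Fin 2) : (idx l s).modNat = s :=
  congrArg Prod.snd (finProdFinEquiv.symm_apply_apply (l, s))

lemma idx_divNat_modNat {n : ℕ} (j : Fin (n * 2)) : idx j.divNat j.modNat = j :=
  finProdFinEquiv.apply_symm_apply j

lemma sum_idx {n : ℕ} {M : Type*} [AddCommMonoid M] (f : Fin (n * 2) → M) :
    ∑ j, f j = ∑ l : Fin n, (f (idx l 0) + f (idx l 1)) := by
  rw [← finProdFinEquiv.sum_comp, Fintype.sum_prod_type]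
  simp [Fin.sum_univ_two]

/-! ### Powers of β. -/

/-- Multiplication by `ω^{2l} ∧ ω^{2l+1}`. -/
def wedgePair {n : ℕ} (l : Fin n) : Module.End ℂ (Coeffs n) :=
  wedgeLeft (idx l 0) * wedgeLeft (idx l 1)

/-- Multiplication by `β = ∑_l ω^{2l} ∧ ω^{2l+1}`. -/
def wedgeBeta (n : ℕ) : Module.End ℂ (Coeffs n) := ∑ l, wedgePair l

/-- A two-form passes ω^j at the cost of two sign changes. -/
lemma commute_wedgePair_wedgeLeft {n : ℕ} (l : Fin n) (j : Fin (n * 2)) :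
    Commute (wedgePair l) (wedgeLeft j) := by
  unfold wedgePair Commute SemiconjBy
  rw [wedgeLeft_mul_mul j, wedgeLeft_anticomm j, mul_smul_comm, smul_smul, mul_assoc]
  simp

lemma commute_wedgePair {n : ℕ} (l m : Fin n) :
    Commute (wedgePair l : Module.End ℂ (Coeffs n)) (wedgePair m) :=
  (commute_wedgePair_wedgeLeft l _).mul_right (commute_wedgePair_wedgeLeft l _)

lemma wedgeLeft_mul_wedgePair {n : ℕ} (l : Fin n) (s : Fin 2) :
    wedgeLeft (idx l s) * wedgePair l = (0 : Module.End ℂ (Coeffs n)) := by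
  fin_cases s
  · simp [wedgePair, ← mul_assoc, wedgeLeft_mul_self]
  · show wedgeLeft (idx l 1) * wedgePair l = _
    rw [← (commute_wedgePair_wedgeLeft l _).eq, wedgePair, mul_assoc, wedgeLeft_mul_self, mul_zero]

lemma wedgePair_mul_self {n : ℕ} (l : Fin n) :
    wedgePair l * wedgePair l = (0 : Module.End ℂ (Coeffs n)) := by
  conv_lhs => lhs; unfold wedgePair
  rw [mul_assoc, wedgeLeft_mul_wedgePair, mul_zero]

/-- The binomial expansion stops after the term linear in x. -/
lemma add_pow_succ_of_mul_self_eq_zero {R : Type*} [Ring R] {x y : R} (h : Commute x y)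
    (hx : x * x = 0) (m : ℕ) : (x + y) ^ (m + 1) = y ^ (m + 1) + (m + 1 : ℕ) • (x * y ^ m) := by
  induction m with
  | zero => simp [add_comm]
  | succ m ih =>
    have hc : x * y ^ m * x = 0 := by
      rw [mul_assoc, (h.pow_right m).eq.symm, ← mul_assoc, hx, zero_mul]
    rw [pow_succ, ih, add_mul, mul_add, mul_add, smul_mul_assoc, smul_mul_assoc, hc, smul_zero,
      zero_add, (h.pow_right (m + 1)).eq.symm, mul_assoc x (y ^ m) y, ← pow_succ, ← pow_succ,
      succ_nsmul _ (m + 1)]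
    abel

/-- The sum of `ω^{2l} ∧ ω^{2l+1}` over `l ∈ s`. -/
def wedgeBetaOn {n : ℕ} (s : Finset (Fin n)) : Module.End ℂ (Coeffs n) := ∑ l ∈ s, wedgePair l

lemma wedgeBetaOn_insert_pow {n : ℕ} {a : Fin n} {s : Finset (Fin n)} (ha : a ∉ s) (m : ℕ) :
    wedgeBetaOn (insert a s) ^ (m + 1) =
      wedgeBetaOn s ^ (m + 1) + (m + 1 : ℕ) • (wedgePair a * wedgeBetaOn s ^ m) := by
  have : wedgeBetaOn (insert a s) = wedgePair a + wedgeBetaOn s := Finset.sum_insert ha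
  rw [this]
  exact add_pow_succ_of_mul_self_eq_zero (Commute.sum_right _ _ _ fun l _ => commute_wedgePair a l)
    (wedgePair_mul_self a) m

/-- A product of more than |s| of the commuting summands repeats one of them, and each has square
zero. -/
lemma wedgeBetaOn_pow_eq_zero {n : ℕ} (s : Finset (Fin n)) {m : ℕ} (hm : s.card < m) :
    wedgeBetaOn s ^ m = 0 := by
  induction s using Finset.induction_on generalizing m with
  | empty => simpa [wedgeBetaOn, pos_iff_ne_zero] using hm
  | insert a s ha ih =>
    rw [Finset.card_insert_of_notMem ha] at hm
    obtain ⟨m, rfl⟩ : ∃ m', m = m' + 1 := ⟨m - 1, by omega⟩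
    rw [wedgeBetaOn_insert_pow ha, ih (by omega), ih (by omega)]
    simp

/-- The indices `2l`, `2l + 1` with `l ∈ s`. -/
def pairs {n : ℕ} (s : Finset (Fin n)) : Finset (Fin (n * 2)) :=
  Finset.univ.filter fun j => j.divNat ∈ s

lemma wedgeLeft_single {n : ℕ} {j : Fin (n * 2)} {S : Finset (Fin (n * 2))} (hj : j ∉ S) :
    wedgeLeft j (Pi.single S 1) =
      (-1 : ℂ) ^ (S.filter (· < j)).card • (Pi.single (insert j S) 1 : Coeffs n) := by
  ext K
  rw [wedgeLeft_apply, Pi.smul_apply, smul_eq_mul, Pi.single_apply, Pi.single_apply]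
  by_cases hK : K = insert j S
  · subst hK
    simp [hj, Finset.filter_insert]
  · by_cases h : j ∈ K
    · have : K.erase j ≠ S := by
        rintro rfl; exact hK (Finset.insert_erase h).symm
      simp [this, hK]
    · simp [h, hK]

lemma wedgePair_single {n : ℕ} {a : Fin n} {s : Finset (Fin n)} (ha : a ∉ s) :
    wedgePair a (Pi.single (pairs s) 1) = (Pi.single (pairs (insert a s)) 1 : Coeffs n) := by
  have h1 : idx a 1 ∉ pairs s := by simp [pairs, ha]
  have h01 : idx a 0 ≠ idx a 1 := by simp
  have h0 : idx a 0 ∉ insert (idx a 1) (pairs s) := by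
    simp only [Finset.mem_insert, h01, false_or]
    simp [pairs, ha]
  have hlt : (idx a 0 : Fin (n * 2)) < idx a 1 := by
    simp [idx, finProdFinEquiv, Fin.lt_def]
  have hins : insert (idx a 0) (insert (idx a 1) (pairs s)) = pairs (insert a s) := by
    ext j
    simp only [pairs, Finset.mem_insert, Finset.mem_filter, Finset.mem_univ, true_and]
    rw [← or_assoc]
    refine or_congr_left ⟨?_, fun h => ?_⟩
    · rintro (rfl | rfl) <;> simp
    · rw [← idx_divNat_modNat j, h]
      generalize j.modNat = t
      fin_cases t <;> simp
  -- No index lies strictly between 2a and 2a+1, so the two insertion signs are equal and their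
  -- product is 1.
  have hfil : (insert (idx a 1) (pairs s)).filter (· < idx a 0) =
      (pairs s).filter (· < idx a 1) := by
    rw [Finset.filter_insert, if_neg hlt.not_gt]
    ext j
    simp only [Finset.mem_filter]
    refine and_congr_right fun hj => ⟨fun h => h.trans hlt, fun h => ?_⟩
    have hne : j ≠ idx a 0 := by
      rintro rfl; exact h0 (Finset.mem_insert_of_mem hj)
    rw [Fin.lt_def] at h ⊢
    rw [Ne, Fin.ext_iff] at hne
    simp only [idx, finProdFinEquiv, Equiv.coe_fn_mk, Fin.isValue, Fin.coe_ofNat_eq_mod] at h hne ⊢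
    omega
  rw [wedgePair, Module.End.mul_apply, wedgeLeft_single h1, map_smul, wedgeLeft_single h0, hfil,
    smul_smul, hins, ← mul_pow]
  simp

/-- The unit of the exterior algebra. -/
abbrev vac (n : ℕ) : Coeffs n := Pi.single ∅ 1

/-- The pairs commute, so each of the |s|! orderings contributes the same monomial. -/
lemma wedgeBetaOn_pow_card {n : ℕ} (s : Finset (Fin n)) :
    (wedgeBetaOn s ^ s.card) (vac n) = (s.card.factorial : ℂ) • Pi.single (pairs s) 1 := by
  induction s using Finset.induction_on with
  | empty => simp [pairs]
  | insert a s ha ih =>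
    rw [Finset.card_insert_of_notMem ha, wedgeBetaOn_insert_pow ha,
      wedgeBetaOn_pow_eq_zero s (Nat.lt_succ_self _), zero_add, LinearMap.smul_apply,
      Module.End.mul_apply, ih, map_smul, wedgePair_single ha, ← Nat.cast_smul_eq_nsmul ℂ,
      smul_smul, Nat.factorial_succ]
    push_cast
    rfl

lemma pairs_univ (n : ℕ) : pairs (Finset.univ : Finset (Fin n)) = Finset.univ := by
  simp [pairs]

lemma wedgeBeta_pow_top (n : ℕ) :
    (wedgeBeta n ^ n) (vac n) = (n.factorial : ℂ) • Pi.single Finset.univ 1 := by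
  have := wedgeBetaOn_pow_card (Finset.univ : Finset (Fin n))
  rwa [Finset.card_univ, Fintype.card_fin, pairs_univ] at this

/-- ω^{2l+t} annihilates the l-th pair, which may therefore be dropped before taking the power. -/
lemma wedgeLeft_mul_wedgeBetaOn_pow {n : ℕ} (l : Fin n) (t : Fin 2) (s : Finset (Fin n)) (m : ℕ) :
    wedgeLeft (idx l t) * wedgeBetaOn s ^ m = wedgeLeft (idx l t) * wedgeBetaOn (s.erase l) ^ m := by
  by_cases h : l ∈ s
  · cases m with
    | zero => simp
    | succ m =>
      conv_lhs => rw [← Finset.insert_erase h]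
      rw [wedgeBetaOn_insert_pow (Finset.notMem_erase l s), mul_add, mul_smul_comm, ← mul_assoc,
        wedgeLeft_mul_wedgePair]
      simp
  · rw [Finset.erase_eq_of_notMem h]

lemma wedgePair_wedgeBeta_pow {n : ℕ} (l : Fin n) :
    wedgePair l ((wedgeBeta n ^ (n - 1)) (vac n)) =
      ((n - 1).factorial : ℂ) • Pi.single Finset.univ 1 := by
  have hc : ((Finset.univ : Finset (Fin n)).erase l).card = n - 1 := by simp
  have h := wedgeBetaOn_pow_card ((Finset.univ : Finset (Fin n)).erase l)
  rw [hc] at h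
  have h2 : wedgePair l * wedgeBeta n ^ (n - 1) =
      wedgePair l * wedgeBetaOn ((Finset.univ : Finset (Fin n)).erase l) ^ (n - 1) := by
    rw [wedgePair, mul_assoc, mul_assoc, ← wedgeLeft_mul_wedgeBetaOn_pow]
    rfl
  rw [← Module.End.mul_apply, h2, Module.End.mul_apply, h, map_smul,
    wedgePair_single (Finset.notMem_erase _ _), Finset.insert_erase (Finset.mem_univ l), pairs_univ]

/-- The two factors remove two different pairs, and the remaining n-2 cannot fill an (n-1)-st power.
Hence only diagonal terms survive in g_0 ∧ g_1 ∧ β^{n-1}. -/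
lemma wedgeLeft_wedgeLeft_wedgeBeta_pow_of_ne {n : ℕ} {l m : Fin n} (h : l ≠ m) (s t : Fin 2) :
    wedgeLeft (idx l s) * wedgeLeft (idx m t) * wedgeBeta n ^ (n - 1) = 0 := by
  have h1 : wedgeBeta n = wedgeBetaOn Finset.univ := rfl
  rw [h1, mul_assoc, wedgeLeft_mul_wedgeBetaOn_pow, wedgeLeft_mul_mul,
    wedgeLeft_mul_wedgeBetaOn_pow, wedgeBetaOn_pow_eq_zero]
  · simp
  · rw [Finset.card_erase_of_mem (by simp [h]), Finset.card_erase_of_mem (Finset.mem_univ _)]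
    simp only [Finset.card_univ, Fintype.card_fin]
    have : 2 ≤ n := by
      have := l.2; have := m.2; have : (l : ℕ) ≠ m := fun e => h (Fin.ext e)
      omega
    omega

/-- `v` is homogeneous of degree `p`. -/
def IsHomogeneous {n : ℕ} (p : ℕ) (v : Coeffs n) : Prop := ∀ K, K.card ≠ p → v K = 0

lemma IsHomogeneous.wedgeLeft {n p : ℕ} {v : Coeffs n} (hv : IsHomogeneous p v)
    (j : Fin (n * 2)) : IsHomogeneous (p + 1) (wedgeLeft j v) := by
  intro K hK
  rw [wedgeLeft_apply]
  split_ifs with h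
  · rw [hv, mul_zero]
    rw [Finset.card_erase_of_mem h]
    have := Finset.card_pos.2 ⟨j, h⟩
    omega
  · rfl

lemma IsHomogeneous.add {n p : ℕ} {v w : Coeffs n} (hv : IsHomogeneous p v)
    (hw : IsHomogeneous p w) : IsHomogeneous p (v + w) := fun K hK => by
  simp [hv K hK, hw K hK]

lemma IsHomogeneous.smul {n p : ℕ} {v : Coeffs n} (hv : IsHomogeneous p v) (c : ℂ) :
    IsHomogeneous p (c • v) := fun K hK => by simp [hv K hK]

lemma IsHomogeneous.sum {n p : ℕ} {ι : Type*} {s : Finset ι} {v : ι → Coeffs n}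
    (hv : ∀ i ∈ s, IsHomogeneous p (v i)) : IsHomogeneous p (∑ i ∈ s, v i) := fun K hK => by
  rw [Finset.sum_apply]
  exact Finset.sum_eq_zero fun i hi => hv i hi K hK

lemma isHomogeneous_wedgeBeta_pow (n k : ℕ) :
    IsHomogeneous (2 * k) ((wedgeBeta n ^ k) (vac n)) := by
  induction k with
  | zero =>
    intro K hK
    have : K ≠ ∅ := by rintro rfl; simp at hK
    simp [this]
  | succ k ih =>
    rw [pow_succ', Module.End.mul_apply]
    nth_rewrite 1 [wedgeBeta]
    rw [LinearMap.sum_apply]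
    refine IsHomogeneous.sum fun l _ => ?_
    rw [wedgePair, Module.End.mul_apply]
    exact (ih.wedgeLeft _).wedgeLeft _

/-! ### Derivatives of forms and integration by parts -/

/-- Reduces every case of the matrix to two real directional derivatives, to which the calculus
lemmas apply. -/
lemma exists_nabla_eq {n : ℕ} (j : Fin (n * 2)) (α : Fin 2) :
    ∃ w₀ w₁ : QSpace n, ∀ (f : QSpace n → ℂ) (q : QSpace n),
      nabla j α f q = fderiv ℝ f q w₀ + Complex.I * fderiv ℝ f q w₁ := by
  obtain ⟨s, hs⟩ : ∃ s, j.modNat = s := ⟨_, rfl⟩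
  let e : Fin 4 → QSpace n := fun a => EuclideanSpace.single (j.divNat, a) 1
  fin_cases s <;> fin_cases α
  · exact ⟨e 0, e 1, fun f q => by simp [nabla, hs, pderiv, e]⟩
  · exact ⟨-e 2, -e 3, fun f q => by simp [nabla, hs, pderiv, e]; ring⟩
  · exact ⟨e 2, -e 3, fun f q => by simp [nabla, hs, pderiv, e]; ring⟩
  · exact ⟨e 0, -e 1, fun f q => by simp [nabla, hs, pderiv, e]; ring⟩

lemma nabla_zero {n : ℕ} (j : Fin (n * 2)) (α : Fin 2) :
    nabla j α (0 : QSpace n → ℂ) = 0 := by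
  obtain ⟨w₀, w₁, h⟩ := exists_nabla_eq j α
  ext q
  simp [h]

lemma contDiff_nabla {n : ℕ} (j : Fin (n * 2)) (α : Fin 2) {f : QSpace n → ℂ}
    {m k : WithTop ℕ∞} (hf : ContDiff ℝ m f) (hk : k + 1 ≤ m) : ContDiff ℝ k (nabla j α f) := by
  obtain ⟨w₀, w₁, h⟩ := exists_nabla_eq j α
  rw [funext (h f)]
  have := hf.fderiv_right hk
  exact (this.clm_apply contDiff_const).add (contDiff_const.mul (this.clm_apply contDiff_const))

lemma hasCompactSupport_nabla {n : ℕ} (j : Fin (n * 2)) (α : Fin 2) {f : QSpace n → ℂ}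
    (hf : HasCompactSupport f) : HasCompactSupport (nabla j α f) := by
  obtain ⟨w₀, w₁, h⟩ := exists_nabla_eq j α
  rw [funext (h f)]
  exact (hf.fderiv_apply (𝕜 := ℝ) w₀).add ((hf.fderiv_apply (𝕜 := ℝ) w₁).mul_left)

lemma d_apply {n : ℕ} (α : Fin 2) (F : Form n) (K : Finset (Fin (n * 2))) (q : QSpace n) :
    d α F K q = ∑ k, wedgeLeft k (fun I => nabla k α (F I) q) K := by
  simp only [d, wedgeLeft_apply, Finset.sum_ite_mem, Finset.univ_inter]

lemma contDiff_d {n : ℕ} (α : Fin 2) {F : Form n} {m k : WithTop ℕ∞}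
    (hF : ∀ I, ContDiff ℝ m (F I)) (hk : k + 1 ≤ m) (K : Finset (Fin (n * 2))) :
    ContDiff ℝ k (d α F K) := by
  unfold d
  exact ContDiff.sum fun j _ => contDiff_const.mul (contDiff_nabla j α (hF _) hk)

lemma hasCompactSupport_d {n : ℕ} (α : Fin 2) {F : Form n}
    (hF : ∀ I, HasCompactSupport (F I)) (K : Finset (Fin (n * 2))) :
    HasCompactSupport (d α F K) := by
  have h : d α F K = ∑ k ∈ K,
      fun q => (-1 : ℂ) ^ (K.filter (· < k)).card * nabla k α (F (K.erase k)) q := by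
    ext q; simp [d]
  rw [h]
  refine Finset.sum_induction _ HasCompactSupport (fun _ _ h1 h2 => h1.add h2)
    HasCompactSupport.zero fun k _ => ?_
  exact (hasCompactSupport_nabla k α (hF _)).mul_left

lemma IsTestForm.d {n : ℕ} (α : Fin 2) {η : Form n} (hη : IsTestForm η) :
    IsTestForm (d α η) := fun K =>
  ⟨contDiff_d α (fun I => (hη I).1) (by simp) K, hasCompactSupport_d α (fun I => (hη I).2) K⟩

lemma IsTestForm.baston {n : ℕ} {η : Form n} (hη : IsTestForm η) : IsTestForm (baston η) :=
  (hη.d 1).d 0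

lemma integrable_mul_of_hasCompactSupport {n : ℕ} {f g : QSpace n → ℂ} (hf : Continuous f)
    (hg : Continuous g) (h : HasCompactSupport g) : Integrable (fun q => f q * g q) :=
  (hf.mul hg).integrable_of_hasCompactSupport h.mul_left

lemma integral_mul_nabla {n : ℕ} (j : Fin (n * 2)) (α : Fin 2) {f g : QSpace n → ℂ}
    (hf : ContDiff ℝ 1 f) (hg : ContDiff ℝ 1 g) (h : HasCompactSupport g) :
    ∫ q, f q * nabla j α g q = -∫ q, nabla j α f q * g q := by
  obtain ⟨w₀, w₁, hw⟩ := exists_nabla_eq j α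
  have hf' (w : QSpace n) : Continuous fun q => fderiv ℝ f q w :=
    (hf.continuous_fderiv one_ne_zero).clm_apply continuous_const
  have hg' (w : QSpace n) : Continuous fun q => fderiv ℝ g q w :=
    (hg.continuous_fderiv one_ne_zero).clm_apply continuous_const
  have hi (w : QSpace n) : Integrable fun q => f q * fderiv ℝ g q w :=
    integrable_mul_of_hasCompactSupport hf.continuous (hg' w) (h.fderiv_apply (𝕜 := ℝ) w)
  have hi' (w : QSpace n) : Integrable fun q => fderiv ℝ f q w * g q :=
    integrable_mul_of_hasCompactSupport (hf' w) hg.continuous h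
  have key (w : QSpace n) : ∫ q, f q * fderiv ℝ g q w = -∫ q, fderiv ℝ f q w * g q :=
    integral_mul_fderiv_eq_neg_fderiv_mul_of_integrable (hi' w) (hi w)
      (integrable_mul_of_hasCompactSupport hf.continuous hg.continuous h)
      (fun x _ => (hf.differentiable one_ne_zero) x)
      (fun x _ => (hg.differentiable one_ne_zero) x)
  simp only [hw, mul_add, add_mul, mul_left_comm (f _) Complex.I, mul_assoc Complex.I]
  rw [integral_add (hi w₀) ((hi w₁).const_mul _), integral_add (hi' w₀) ((hi' w₁).const_mul _),
    integral_const_mul, integral_const_mul, key, key]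
  ring

lemma prod_sign {ι : Type*} (s : Finset ι) (p : ι → Prop) [DecidablePred p] :
    ∏ i ∈ s, (if p i then (-1 : ℂ) else 1) = (-1 : ℂ) ^ (s.filter p).card := by
  rw [Finset.prod_ite]; simp

/-- The sign in the graded Leibniz rule d_α(c ∧ η) = d_αc ∧ η + (-1)^p c ∧ d_αη, read off on
coefficients. -/
lemma wedgeSign_mul_sign {n : ℕ} {k : Fin (n * 2)} {I : Finset (Fin (n * 2))} (hk : k ∉ I) :
    wedgeSign I * (-1 : ℂ) ^ (Iᶜ.filter (· < k)).card =
      (-1 : ℂ) ^ I.card *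
        (wedgeSign (insert k I) * (-1 : ℂ) ^ ((insert k I).filter (· < k)).card) := by
  have hc : Iᶜ = insert k (insert k I)ᶜ := by
    ext i; by_cases h : i = k <;> simp [h, hk]
  have hkc : k ∉ (insert k I)ᶜ := by simp
  simp only [wedgeSign]
  -- Written as products over pairs of indices, the signs split off one factor per index when k is
  -- inserted.
  rw [← prod_sign, ← prod_sign, ← prod_sign, ← prod_sign, Finset.prod_product,
    Finset.prod_product, Finset.prod_insert hk, hc, Finset.prod_insert hkc,
    Finset.prod_insert hk]
  simp only [lt_irrefl, if_false, one_mul, Finset.prod_insert hkc, Finset.prod_mul_distrib]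
  have : ∏ i ∈ I, (if k < i then (-1 : ℂ) else 1) =
      (-1 : ℂ) ^ I.card * ∏ i ∈ I, (if i < k then (-1 : ℂ) else 1) := by
    rw [← Finset.prod_const, ← Finset.prod_mul_distrib]
    refine Finset.prod_congr rfl fun i hi => ?_
    have hne : i ≠ k := fun e => hk (e ▸ hi)
    rcases hne.lt_or_gt with h | h <;> simp [h, h.not_gt]
  rw [this]
  ring

/-- Stokes: the integral of d_α(c ∧ η) vanishes. Homogeneity of c makes the sign of the Leibniz rule
the same for all terms. -/
lemma pairing_d {n : ℕ} (α : Fin 2) {p : ℕ} {c η : Form n} (hc : ∀ I, ContDiff ℝ 1 (c I))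
    (hp : ∀ q, IsHomogeneous p fun I => c I q) (hη : ∀ I, ContDiff ℝ 2 (η I))
    (hs : ∀ I, HasCompactSupport (η I)) :
    pairing volume c (d α η) = -((-1 : ℂ) ^ p * pairing volume (d α c) η) := by
  have h1 (I) : wedgeSign I * ∫ q, c I q * d α η Iᶜ q =
      ∑ k ∈ Iᶜ, -(wedgeSign I * (-1 : ℂ) ^ (Iᶜ.filter (· < k)).card *
        ∫ q, nabla k α (c I) q * η (Iᶜ.erase k) q) := by
    simp only [d, Finset.mul_sum]
    rw [integral_finsetSum, Finset.mul_sum]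
    · refine Finset.sum_congr rfl fun k _ => ?_
      have := integral_mul_nabla k α (hc I) ((hη (Iᶜ.erase k)).of_le one_le_two) (hs _)
      simp only [mul_left_comm (c I _)]
      rw [integral_const_mul, this]
      ring
    · intro k _
      refine integrable_mul_of_hasCompactSupport (hc I).continuous
        (continuous_const.mul (contDiff_nabla k α (hη _) (k := 0) (by norm_num)).continuous)
        (hasCompactSupport_nabla k α (hs _)).mul_left
  have h2 (J) : wedgeSign J * ∫ q, d α c J q * η Jᶜ q =
      ∑ k ∈ J, wedgeSign J * (-1 : ℂ) ^ (J.filter (· < k)).card *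
        ∫ q, nabla k α (c (J.erase k)) q * η Jᶜ q := by
    simp only [d, Finset.sum_mul]
    rw [integral_finsetSum, Finset.mul_sum]
    · refine Finset.sum_congr rfl fun k _ => ?_
      simp only [mul_assoc]
      rw [integral_const_mul]
    · intro k _
      exact integrable_mul_of_hasCompactSupport
        (continuous_const.mul (contDiff_nabla k α (hc _) (k := 0) (by norm_num)).continuous)
        (hη _).continuous (hs _)
  unfold pairing
  rw [Finset.sum_congr rfl fun I _ => h1 I, Finset.sum_congr rfl fun I _ => h2 I,
    Finset.sum_sigma', Finset.sum_sigma', Finset.mul_sum, ← Finset.sum_neg_distrib]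
  -- Pairs (I, k) with k ∉ I correspond to pairs (J, k) with k ∈ J through J = I ∪ {k}.
  refine Finset.sum_bij' (fun x _ => ⟨insert x.2 x.1, x.2⟩) (fun x _ => ⟨x.1.erase x.2, x.2⟩)
    ?_ ?_ ?_ ?_ ?_
  · rintro ⟨I, k⟩ h; simp
  · rintro ⟨I, k⟩ h; simp
  · rintro ⟨I, k⟩ h
    simp only [Finset.mem_sigma, Finset.mem_compl] at h
    simp [h.2]
  · rintro ⟨I, k⟩ h
    simp only [Finset.mem_sigma] at h
    simp [h.2]
  · rintro ⟨I, k⟩ h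
    simp only [Finset.mem_sigma, Finset.mem_compl, Finset.mem_univ, true_and] at h
    simp only [Finset.erase_insert h, wedgeSign_mul_sign h, Finset.compl_insert]
    by_cases hI : I.card = p
    · rw [hI]; ring
    · have : c I = 0 := funext fun q => hp q I hI
      simp [this, nabla_zero]

/-! ### The regularised powers -/

/-- `∇_{jα} ‖q‖² / 2`. -/
def halfGrad {n : ℕ} (α : Fin 2) (j : Fin (n * 2)) (q : QSpace n) : ℂ :=
  let x : Fin 4 → ℂ := fun a => (q (j.divNat, a) : ℂ)
  !![x 0 + Complex.I * x 1, -x 2 - Complex.I * x 3;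
     x 2 - Complex.I * x 3, x 0 - Complex.I * x 1] j.modNat α

/-- The operator of left multiplication by `∑_j halfGrad α j ω^j`. -/
def gradOp {n : ℕ} (α : Fin 2) (q : QSpace n) : Module.End ℂ (Coeffs n) :=
  ∑ j, halfGrad α j q • wedgeLeft j

lemma pderiv_radial {n : ℕ} (l : Fin n) (a : Fin 4) {φ : ℝ → ℝ} {φ' : ℝ} {q : QSpace n}
    (h : HasDerivAt φ φ' (‖q‖ ^ 2)) :
    pderiv l a (fun q => (φ (‖q‖ ^ 2) : ℂ)) q = 2 * φ' * q (l, a) := by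
  have h1 : HasFDerivAt (fun q : QSpace n => φ (‖q‖ ^ 2)) (φ' • (2 • innerSL ℝ q)) q :=
    h.comp_hasFDerivAt q (hasStrictFDerivAt_norm_sq q).hasFDerivAt
  have h2 := Complex.ofRealCLM.hasFDerivAt.comp q h1
  unfold pderiv
  have h3 : fderiv ℝ (fun q : QSpace n => (φ (‖q‖ ^ 2) : ℂ)) q = _ := h2.fderiv
  rw [h3]
  simp [EuclideanSpace.inner_single_right]
  ring

lemma nabla_radial {n : ℕ} (j : Fin (n * 2)) (α : Fin 2) {φ : ℝ → ℝ} {φ' : ℝ} {q : QSpace n}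
    (h : HasDerivAt φ φ' (‖q‖ ^ 2)) :
    nabla j α (fun q => (φ (‖q‖ ^ 2) : ℂ)) q = 2 * φ' * halfGrad α j q := by
  unfold nabla halfGrad
  simp only [pderiv_radial _ _ h]
  generalize j.modNat = s
  fin_cases s <;> fin_cases α <;> simp <;> ring

/-- `(‖q‖² + ε)⁻¹`. -/
def regInv {n : ℕ} (ε : ℝ) (q : QSpace n) : ℂ := (((‖q‖ ^ 2 + ε)⁻¹ : ℝ) : ℂ)

lemma nabla_regInv_pow {n : ℕ} (j : Fin (n * 2)) (α : Fin 2) {ε : ℝ} (hε : 0 < ε) (p : ℕ)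
    (q : QSpace n) :
    nabla j α (fun q => regInv ε q ^ p) q = -(2 * p * regInv ε q ^ (p + 1)) * halfGrad α j q := by
  have hpos : ‖q‖ ^ 2 + ε ≠ 0 := by positivity
  have h : HasDerivAt (fun x : ℝ => (x + ε)⁻¹ ^ p) (-(p * (‖q‖ ^ 2 + ε)⁻¹ ^ (p + 1)))
      (‖q‖ ^ 2) := by
    refine ((((hasDerivAt_id (‖q‖ ^ 2)).add_const ε).fun_inv hpos).fun_pow p).congr_deriv ?_
    cases p with
    | zero => simp
    | succ p => simp; field_simp; ring
  have := nabla_radial j α h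
  simp only [regInv]
  push_cast at this ⊢
  rw [this]
  ring

lemma contDiff_regInv {n : ℕ} {ε : ℝ} (hε : 0 < ε) {m : WithTop ℕ∞} :
    ContDiff ℝ m (regInv ε : QSpace n → ℂ) := by
  refine Complex.ofRealCLM.contDiff.comp (ContDiff.inv ?_ fun q => by positivity)
  exact (contDiff_norm_sq ℝ).add contDiff_const

/-! ### Second derivatives of ‖q‖² and the form β. -/

/-- A complex linear combination of two coordinates. -/
def linForm {n : ℕ} (c₁ c₂ : ℂ) (x y : Fin n × Fin 4) (q : QSpace n) : ℂ :=
  c₁ * (q x : ℂ) + c₂ * (q y : ℂ)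

lemma pderiv_linForm {n : ℕ} (l : Fin n) (a : Fin 4) (c₁ c₂ : ℂ) (x y : Fin n × Fin 4)
    (q : QSpace n) :
    pderiv l a (linForm c₁ c₂ x y) q =
      c₁ * (if x = (l, a) then 1 else 0) + c₂ * (if y = (l, a) then 1 else 0) := by
  have h (x : Fin n × Fin 4) :
      HasFDerivAt (fun q : QSpace n => (q x : ℂ))
        (Complex.ofRealCLM.comp (EuclideanSpace.proj x : QSpace n →L[ℝ] ℝ)) q :=
    (Complex.ofRealCLM.comp (EuclideanSpace.proj x : QSpace n →L[ℝ] ℝ)).hasFDerivAt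
  unfold pderiv linForm
  rw [(((h x).const_mul c₁).fun_add ((h y).const_mul c₂)).fderiv]
  simp
  split_ifs <;> simp

lemma halfGrad_eq {n : ℕ} (l : Fin n) :
    (halfGrad 0 (idx l 0) : QSpace n → ℂ) = linForm 1 Complex.I (l, 0) (l, 1) ∧
    (halfGrad 1 (idx l 0) : QSpace n → ℂ) = linForm (-1) (-Complex.I) (l, 2) (l, 3) ∧
    (halfGrad 0 (idx l 1) : QSpace n → ℂ) = linForm 1 (-Complex.I) (l, 2) (l, 3) ∧
    (halfGrad 1 (idx l 1) : QSpace n → ℂ) = linForm 1 (-Complex.I) (l, 0) (l, 1) := by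
  refine ⟨?_, ?_, ?_, ?_⟩ <;> ext q <;> simp [halfGrad, linForm] <;> ring

lemma contDiff_halfGrad {n : ℕ} (α : Fin 2) (j : Fin (n * 2)) {m : WithTop ℕ∞} :
    ContDiff ℝ m (halfGrad α j : QSpace n → ℂ) := by
  have h (c₁ c₂ : ℂ) (x y : Fin n × Fin 4) :
      ContDiff ℝ m (linForm c₁ c₂ x y : QSpace n → ℂ) := by
    have h' (x : Fin n × Fin 4) : ContDiff ℝ m (fun q : QSpace n => (q x : ℂ)) :=
      (Complex.ofRealCLM.comp (EuclideanSpace.proj x : QSpace n →L[ℝ] ℝ)).contDiff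
    exact (contDiff_const.mul (h' x)).add (contDiff_const.mul (h' y))
  obtain ⟨l, s, rfl⟩ : ∃ l s, j = idx l s := ⟨_, _, (idx_divNat_modNat j).symm⟩
  obtain ⟨h1, h2, h3, h4⟩ := halfGrad_eq (n := n) l
  fin_cases s <;> fin_cases α
  · exact h1 ▸ h _ _ _ _
  · exact h2 ▸ h _ _ _ _
  · exact h3 ▸ h _ _ _ _
  · exact h4 ▸ h _ _ _ _

lemma nabla_halfGrad_of_ne {n : ℕ} {l m : Fin n} (h : l ≠ m) (s t α β : Fin 2) (q : QSpace n) :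
    nabla (idx l s) α (halfGrad β (idx m t)) q = 0 := by
  obtain ⟨h1, h2, h3, h4⟩ := halfGrad_eq (n := n) m
  unfold nabla
  fin_cases t <;> fin_cases β <;> fin_cases s <;> fin_cases α <;>
    simp [-finProdFinEquiv_apply_val, h1, h2, h3, h4, pderiv_linForm, h.symm]

/-- The constant `2`-form `∑_{m,i} (∇_{mα} halfGrad β i) ω^m ∧ ω^i`. -/
def hessOp {n : ℕ} (α β : Fin 2) (q : QSpace n) : Module.End ℂ (Coeffs n) :=
  ∑ i, ∑ m, nabla m α (halfGrad β i) q • (wedgeLeft m * wedgeLeft i)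

/-- Different quaternionic coordinates do not interact, and within one block the terms with a
repeated ω vanish. -/
lemma hessOp_eq_sum {n : ℕ} (α β : Fin 2) (q : QSpace n) :
    hessOp α β q = ∑ l : Fin n,
      (nabla (idx l 0) α (halfGrad β (idx l 1)) q - nabla (idx l 1) α (halfGrad β (idx l 0)) q) •
        wedgePair l := by
  unfold hessOp
  rw [sum_idx]
  refine Finset.sum_congr rfl fun l _ => ?_
  rw [sum_idx, sum_idx, Finset.sum_eq_single l, Finset.sum_eq_single l]
  · simp only [wedgeLeft_mul_self, smul_zero, zero_add, add_zero]
    rw [wedgeLeft_anticomm (idx l 1), ← wedgePair, smul_smul, ← add_smul]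
    congr 1; ring
  · intro m _ hm; simp [nabla_halfGrad_of_ne hm]
  · simp
  · intro m _ hm; simp [nabla_halfGrad_of_ne hm]
  · simp

lemma hessOp_zero_zero {n : ℕ} (q : QSpace n) : hessOp 0 0 q = 0 := by
  rw [hessOp_eq_sum]
  refine Finset.sum_eq_zero fun l _ => ?_
  obtain ⟨h1, h2, h3, h4⟩ := halfGrad_eq (n := n) l
  simp [h1, h3, nabla, pderiv_linForm]

/-- Each of the four real coordinates of q_l contributes 1. -/
lemma hessOp_zero_one {n : ℕ} (q : QSpace n) : hessOp 0 1 q = (4 : ℂ) • wedgeBeta n := by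
  rw [hessOp_eq_sum, wedgeBeta, Finset.smul_sum]
  refine Finset.sum_congr rfl fun l _ => ?_
  obtain ⟨h1, h2, h3, h4⟩ := halfGrad_eq (n := n) l
  simp [h2, h4, nabla, pderiv_linForm]
  norm_num

lemma hessOp_one_zero {n : ℕ} (q : QSpace n) : hessOp 1 0 q = (-4 : ℂ) • wedgeBeta n := by
  rw [hessOp_eq_sum, wedgeBeta, Finset.smul_sum]
  refine Finset.sum_congr rfl fun l _ => ?_
  obtain ⟨h1, h2, h3, h4⟩ := halfGrad_eq (n := n) l
  simp [h1, h3, nabla, pderiv_linForm]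
  norm_num
  exact neg_smul (4 : ℂ) (wedgePair l)

/-! ### Product rules for d_α on form-valued functions. -/

/-- The operator `d_α` on functions with values in the exterior algebra. -/
def dVec {n : ℕ} (α : Fin 2) (F : QSpace n → Coeffs n) (q : QSpace n) : Coeffs n :=
  ∑ k, wedgeLeft k fun I => nabla k α (fun q => F q I) q

lemma d_eq_dVec {n : ℕ} (α : Fin 2) (F : QSpace n → Coeffs n) :
    d α (fun I q => F q I) = fun I q => dVec α F q I := by
  ext K q
  rw [d_apply, dVec, Finset.sum_apply]

/-- The same directions w₀, w₁ serve scalar and vector functions, so that both derivatives can be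
compared in the product rule. -/
lemma nabla_vec {n : ℕ} (k : Fin (n * 2)) (α : Fin 2) :
    ∃ w₀ w₁ : QSpace n, (∀ (f : QSpace n → ℂ) (q : QSpace n),
      nabla k α f q = fderiv ℝ f q w₀ + Complex.I * fderiv ℝ f q w₁) ∧
      ∀ (F : QSpace n → Coeffs n) (q : QSpace n), DifferentiableAt ℝ F q →
      (fun I => nabla k α (fun q => F q I) q) =
        fderiv ℝ F q w₀ + Complex.I • fderiv ℝ F q w₁ := by
  obtain ⟨w₀, w₁, h⟩ := exists_nabla_eq k α
  refine ⟨w₀, w₁, h, fun F q hF => funext fun I => ?_⟩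
  rw [h, fderiv_apply hF I]
  simp

lemma dVec_const {n : ℕ} (α : Fin 2) (v : Coeffs n) : dVec α (fun _ => v) = 0 := by
  ext q : 1
  refine Finset.sum_eq_zero fun k _ => ?_
  obtain ⟨w₀, w₁, -, h⟩ := nabla_vec k α
  rw [h _ _ (differentiableAt_const v)]
  simp

lemma dVec_add {n : ℕ} (α : Fin 2) {F G : QSpace n → Coeffs n} (hF : Differentiable ℝ F)
    (hG : Differentiable ℝ G) : dVec α (fun q => F q + G q) = fun q => dVec α F q + dVec α G q := by
  ext q : 1
  unfold dVec
  rw [← Finset.sum_add_distrib]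
  refine Finset.sum_congr rfl fun k _ => ?_
  obtain ⟨w₀, w₁, -, h⟩ := nabla_vec k α
  rw [h _ _ ((hF q).fun_add (hG q)), h _ _ (hF q), h _ _ (hG q), fderiv_fun_add (hF q) (hG q), ← map_add]
  congr 1
  simp; abel

lemma dVec_sum {n : ℕ} (α : Fin 2) {ι : Type*} (s : Finset ι) {F : ι → QSpace n → Coeffs n}
    (hF : ∀ i, Differentiable ℝ (F i)) :
    dVec α (fun q => ∑ i ∈ s, F i q) = fun q => ∑ i ∈ s, dVec α (F i) q := by
  classical
  induction s using Finset.induction_on with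
  | empty => simp only [Finset.sum_empty]; exact dVec_const α 0
  | insert a s ha ih =>
    simp only [Finset.sum_insert ha]
    rw [dVec_add α (hF a) (Differentiable.fun_sum fun i _ => hF i), ih]

lemma dVec_smul {n : ℕ} (α : Fin 2) {f : QSpace n → ℂ} {F : QSpace n → Coeffs n}
    (hf : Differentiable ℝ f) (hF : Differentiable ℝ F) :
    dVec α (fun q => f q • F q) =
      fun q => (∑ k, nabla k α f q • wedgeLeft k) (F q) + f q • dVec α F q := by
  ext q : 1
  unfold dVec
  rw [Finset.smul_sum, LinearMap.sum_apply, ← Finset.sum_add_distrib]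
  refine Finset.sum_congr rfl fun k _ => ?_
  obtain ⟨w₀, w₁, h', h⟩ := nabla_vec k α
  rw [h _ _ ((hf q).fun_smul (hF q)), h _ _ (hF q), fderiv_fun_smul (hf q) (hF q), LinearMap.smul_apply,
    ← map_smul (wedgeLeft k), ← map_smul (wedgeLeft k), ← map_add, h']
  congr 1
  have h2 (w : QSpace n) : (f q • fderiv ℝ F q + (fderiv ℝ f q).smulRight (F q)) w =
      f q • fderiv ℝ F q w + fderiv ℝ f q w • F q := rfl
  rw [h2, h2]
  module

lemma dVec_const_smul {n : ℕ} (α : Fin 2) (c : ℂ) {F : QSpace n → Coeffs n}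
    (hF : Differentiable ℝ F) : dVec α (fun q => c • F q) = fun q => c • dVec α F q := by
  rw [dVec_smul α (differentiable_const c) hF]
  ext q : 1
  have : ∑ k, nabla k α (fun _ : QSpace n => c) q • wedgeLeft k = 0 := by
    refine Finset.sum_eq_zero fun k _ => ?_
    obtain ⟨w₀, w₁, h⟩ := exists_nabla_eq k α
    simp [h]
  rw [this]; simp

lemma differentiable_map {n : ℕ} (X : Module.End ℂ (Coeffs n)) {F : QSpace n → Coeffs n}
    (hF : Differentiable ℝ F) : Differentiable ℝ fun q => X (F q) :=
  ((LinearMap.toContinuousLinearMap X).restrictScalars ℝ).differentiable.comp hF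

lemma dVec_wedgeLeft {n : ℕ} (α : Fin 2) (i : Fin (n * 2)) {F : QSpace n → Coeffs n}
    (hF : Differentiable ℝ F) :
    dVec α (fun q => wedgeLeft i (F q)) = fun q => (-1 : ℂ) • wedgeLeft i (dVec α F q) := by
  ext q : 1
  unfold dVec
  rw [map_sum, Finset.smul_sum]
  refine Finset.sum_congr rfl fun k _ => ?_
  obtain ⟨w₀, w₁, -, h⟩ := nabla_vec k α
  rw [h _ _ (differentiable_map _ hF q), h _ _ (hF q), ← Module.End.mul_apply,
    ← LinearMap.smul_apply, ← wedgeLeft_anticomm, Module.End.mul_apply]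
  have h2 : HasFDerivAt (fun q => wedgeLeft i (F q))
      (((LinearMap.toContinuousLinearMap (wedgeLeft i)).restrictScalars ℝ).comp (fderiv ℝ F q)) q :=
    ((LinearMap.toContinuousLinearMap (wedgeLeft i)).restrictScalars ℝ).hasFDerivAt.comp q
      (hF q).hasFDerivAt
  rw [h2.fderiv, map_add (wedgeLeft i), map_smul (wedgeLeft i)]
  rfl

lemma differentiable_halfGrad {n : ℕ} (α : Fin 2) (j : Fin (n * 2)) :
    Differentiable ℝ (halfGrad α j : QSpace n → ℂ) :=
  (contDiff_halfGrad α j (m := 1)).differentiable one_ne_zero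

lemma differentiable_gradOp {n : ℕ} (α : Fin 2) {F : QSpace n → Coeffs n}
    (hF : Differentiable ℝ F) : Differentiable ℝ fun q => gradOp α q (F q) := by
  simp only [gradOp, LinearMap.sum_apply, LinearMap.smul_apply]
  exact Differentiable.fun_sum fun i _ => (differentiable_halfGrad α i).smul (differentiable_map _ hF)

/-- Leibniz rule for a one-form factor: `hessOp` is d_α g_β, and d_α changes sign when it passes
g_β. -/
lemma dVec_gradOp {n : ℕ} (α β : Fin 2) {F : QSpace n → Coeffs n} (hF : Differentiable ℝ F) :
    dVec α (fun q => gradOp β q (F q)) =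
      fun q => hessOp α β q (F q) + (-1 : ℂ) • gradOp β q (dVec α F q) := by
  have h : (fun q => gradOp β q (F q)) = fun q => ∑ i, halfGrad β i q • wedgeLeft i (F q) := by
    ext q : 1; simp [gradOp]
  rw [h, dVec_sum α _ fun i => (differentiable_halfGrad β i).fun_smul (differentiable_map _ hF)]
  ext q : 1
  simp only [hessOp, gradOp, LinearMap.sum_apply, Finset.smul_sum]
  rw [← Finset.sum_add_distrib]
  refine Finset.sum_congr rfl fun i _ => ?_
  rw [dVec_smul α (differentiable_halfGrad β i) (differentiable_map _ hF), dVec_wedgeLeft α i hF]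
  simp only [LinearMap.sum_apply, LinearMap.smul_apply, Module.End.mul_apply]
  rw [smul_comm]

lemma gradOp_mul_self {n : ℕ} (α : Fin 2) (q : QSpace n) : gradOp α q * gradOp α q = 0 := by
  have h : gradOp α q * gradOp α q = ∑ i, ∑ j, (halfGrad α i q * halfGrad α j q) •
      (wedgeLeft i * wedgeLeft j) := by
    simp only [gradOp, Finset.sum_mul_sum, smul_mul_smul_comm]
  have h2 : gradOp α q * gradOp α q = (-1 : ℂ) • (gradOp α q * gradOp α q) := by
    conv_lhs => rw [h, Finset.sum_comm]
    rw [h, Finset.smul_sum]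
    refine Finset.sum_congr rfl fun i _ => ?_
    rw [Finset.smul_sum]
    refine Finset.sum_congr rfl fun j _ => ?_
    rw [wedgeLeft_anticomm j i, mul_comm (halfGrad α j q), smul_comm]
  have h3 : (2 : ℂ) • (gradOp α q * gradOp α q) = 0 := by
    rw [two_smul]; nth_rewrite 1 [h2]; module
  exact (smul_eq_zero.1 h3).resolve_left two_ne_zero

lemma gradOp_anticomm {n : ℕ} (α β : Fin 2) (q : QSpace n) :
    gradOp α q * gradOp β q = (-1 : ℂ) • (gradOp β q * gradOp α q) := by
  have h (α β : Fin 2) : gradOp α q * gradOp β q =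
      ∑ i, ∑ j, (halfGrad α i q * halfGrad β j q) • (wedgeLeft i * wedgeLeft j) := by
    simp only [gradOp, Finset.sum_mul_sum, smul_mul_smul_comm]
  rw [h, h, Finset.sum_comm, Finset.smul_sum]
  refine Finset.sum_congr rfl fun i _ => ?_
  rw [Finset.smul_sum]
  refine Finset.sum_congr rfl fun j _ => ?_
  rw [wedgeLeft_anticomm j i, mul_comm (halfGrad α j q), smul_comm]

lemma differentiable_regInv_pow {n : ℕ} {ε : ℝ} (hε : 0 < ε) (p : ℕ) :
    Differentiable ℝ (fun q : QSpace n => regInv ε q ^ p) :=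
  ((contDiff_regInv hε (m := 1)).pow p).differentiable one_ne_zero

lemma dVec_regInv_pow_smul {n : ℕ} (α : Fin 2) {ε : ℝ} (hε : 0 < ε) (p : ℕ)
    {F : QSpace n → Coeffs n} (hF : Differentiable ℝ F) :
    dVec α (fun q => regInv ε q ^ p • F q) = fun q =>
      (-(2 * p * regInv ε q ^ (p + 1))) • gradOp α q (F q) + regInv ε q ^ p • dVec α F q := by
  rw [dVec_smul α (differentiable_regInv_pow hε p) hF]
  ext q : 1
  simp only [nabla_regInv_pow _ _ hε, mul_smul _ (halfGrad _ _ _), ← Finset.smul_sum]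
  rfl

/-- The coefficients of `(△u_ε)^k`, where `u_ε = -1 / (‖q‖² + ε)`. -/
def powVec {n : ℕ} (k : ℕ) (ε : ℝ) (q : QSpace n) : Coeffs n :=
  (8 : ℂ) ^ k • (regInv ε q ^ (2 * k) • (wedgeBeta n ^ k) (vac n) -
    (k * regInv ε q ^ (2 * k + 1)) • gradOp 0 q (gradOp 1 q ((wedgeBeta n ^ (k - 1)) (vac n))))

/-- The coefficients of `d₀ (u_ε (△u_ε)^k)`. -/
def halfVec {n : ℕ} (k : ℕ) (ε : ℝ) (q : QSpace n) : Coeffs n :=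
  (2 * (8 : ℂ) ^ k) • regInv ε q ^ (2 * k + 2) • gradOp 0 q ((wedgeBeta n ^ k) (vac n))

lemma dVec_gradOp_const {n : ℕ} (w : Coeffs n) :
    dVec 0 (fun q => gradOp 1 q w) = fun _ => (4 : ℂ) • wedgeBeta n w := by
  rw [dVec_gradOp 0 1 (differentiable_const w), dVec_const]
  ext q : 1
  simp [hessOp_zero_one]

lemma dVec_gradOp_gradOp_const {n : ℕ} (w : Coeffs n) :
    dVec 0 (fun q => gradOp 0 q (gradOp 1 q w)) =
      fun q => (-4 : ℂ) • gradOp 0 q (wedgeBeta n w) := by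
  rw [dVec_gradOp 0 0 (differentiable_gradOp 1 (differentiable_const w)), dVec_gradOp_const]
  ext q : 1
  simp [hessOp_zero_zero, smul_smul]

/-- Differentiating s^{2k+1} gives 2(2k+1), differentiating g_0 ∧ g_1 gives -4k, and 2 remains; the
term with g_0 ∧ g_0 vanishes. -/
lemma dVec_zero_regInv_smul_powVec {n : ℕ} (k : ℕ) {ε : ℝ} (hε : 0 < ε) :
    dVec 0 (fun q : QSpace n => (-regInv ε q) • powVec k ε q) = halfVec k ε := by
  set v := (wedgeBeta n ^ k) (vac n) with hv
  set w := (wedgeBeta n ^ (k - 1)) (vac n) with hw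
  have h1 : (fun q : QSpace n => (-regInv ε q) • powVec k ε q) = fun q =>
      (-(8 : ℂ) ^ k) • (regInv ε q ^ (2 * k + 1) • v) +
        ((8 : ℂ) ^ k * k) • (regInv ε q ^ (2 * k + 2) • gradOp 0 q (gradOp 1 q w)) := by
    ext q : 1
    simp only [powVec]
    module
  have d1 : Differentiable ℝ fun q : QSpace n => regInv ε q ^ (2 * k + 1) • v :=
    (differentiable_regInv_pow hε _).fun_smul (differentiable_const v)
  have d2' : Differentiable ℝ fun q : QSpace n => gradOp 0 q (gradOp 1 q w) :=
    differentiable_gradOp 0 (differentiable_gradOp 1 (differentiable_const w))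
  have d2 : Differentiable ℝ fun q : QSpace n =>
      regInv ε q ^ (2 * k + 2) • gradOp 0 q (gradOp 1 q w) :=
    (differentiable_regInv_pow hε _).fun_smul d2'
  rw [h1, dVec_add 0 (d1.fun_const_smul _) (d2.fun_const_smul _), dVec_const_smul 0 _ d1,
    dVec_const_smul 0 _ d2, dVec_regInv_pow_smul 0 hε _ (differentiable_const v),
    dVec_regInv_pow_smul 0 hε _ d2', dVec_gradOp_gradOp_const, dVec_const]
  ext q : 1
  have h2 : gradOp 0 q (gradOp 0 q (gradOp 1 q w)) = 0 := by
    rw [← Module.End.mul_apply, gradOp_mul_self, LinearMap.zero_apply]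
  -- The factor k makes the truncated exponent k - 1 harmless at k = 0.
  have h3 : (k : ℂ) • wedgeBeta n w = (k : ℂ) • v := by
    cases k with
    | zero => simp
    | succ k => rw [hv, hw, pow_succ', Module.End.mul_apply]; rfl
  have h4 : (k : ℂ) • gradOp 0 q (wedgeBeta n w) = (k : ℂ) • gradOp 0 q v := by
    rw [← map_smul, h3, map_smul]
  simp only [h2, smul_zero, zero_add, Pi.zero_apply, add_zero, halfVec, ← hv]
  have h5 : ((8 : ℂ) ^ k * k) • regInv ε q ^ (2 * k + 2) • (-4 : ℂ) • gradOp 0 q (wedgeBeta n w) =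
      (-4 * (8 : ℂ) ^ k * regInv ε q ^ (2 * k + 2)) • ((k : ℂ) • gradOp 0 q (wedgeBeta n w)) := by
    module
  rw [h5, h4]
  push_cast
  module

/-- The minus sign reflects d_1 d_0 = -d_0 d_1: the derivatives are applied here in the order
opposite to △. -/
lemma dVec_one_halfVec {n : ℕ} (k : ℕ) {ε : ℝ} (hε : 0 < ε) :
    dVec 1 (halfVec k ε : QSpace n → Coeffs n) = fun q => (-1 : ℂ) • powVec (k + 1) ε q := by
  set v := (wedgeBeta n ^ k) (vac n) with hv
  have d2' : Differentiable ℝ fun q : QSpace n => gradOp 0 q v :=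
    differentiable_gradOp 0 (differentiable_const v)
  have d2 : Differentiable ℝ fun q : QSpace n => regInv ε q ^ (2 * k + 2) • gradOp 0 q v :=
    (differentiable_regInv_pow hε _).fun_smul d2'
  have h1 : (halfVec k ε : QSpace n → Coeffs n) = fun q =>
      (2 * (8 : ℂ) ^ k) • (regInv ε q ^ (2 * k + 2) • gradOp 0 q v) := rfl
  rw [h1, dVec_const_smul 1 _ d2, dVec_regInv_pow_smul 1 hε _ d2',
    dVec_gradOp 1 0 (differentiable_const v), dVec_const]
  ext q : 1
  have h2 : gradOp 1 q (gradOp 0 q v) = (-1 : ℂ) • gradOp 0 q (gradOp 1 q v) := by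
    rw [← Module.End.mul_apply, gradOp_anticomm, LinearMap.smul_apply, Module.End.mul_apply]
  have h3 : (wedgeBeta n ^ (k + 1)) (vac n) = wedgeBeta n v := by
    rw [pow_succ', Module.End.mul_apply]
  simp only [h2, hessOp_one_zero, Pi.zero_apply, map_zero, smul_zero, add_zero, powVec, h3,
    LinearMap.smul_apply, Nat.add_sub_cancel, ← hv]
  push_cast
  module

/-! ### Smoothness and degree of the explicit coefficients. -/

lemma contDiff_gradOp {n : ℕ} (α : Fin 2) {F : QSpace n → Coeffs n} {m : WithTop ℕ∞}
    (hF : ContDiff ℝ m F) : ContDiff ℝ m fun q => gradOp α q (F q) := by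
  simp only [gradOp, LinearMap.sum_apply, LinearMap.smul_apply]
  exact ContDiff.sum fun i _ => (contDiff_halfGrad α i).smul
    (((LinearMap.toContinuousLinearMap (wedgeLeft i)).restrictScalars ℝ).contDiff.comp hF)

lemma contDiff_powVec {n : ℕ} (k : ℕ) {ε : ℝ} (hε : 0 < ε) {m : WithTop ℕ∞} :
    ContDiff ℝ m (powVec k ε : QSpace n → Coeffs n) := by
  unfold powVec
  exact ((((contDiff_regInv hε).pow _).smul contDiff_const).sub
    ((contDiff_const.mul ((contDiff_regInv hε).pow _)).smul
      (contDiff_gradOp 0 (contDiff_gradOp 1 contDiff_const)))).const_smul _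

lemma contDiff_halfVec {n : ℕ} (k : ℕ) {ε : ℝ} (hε : 0 < ε) {m : WithTop ℕ∞} :
    ContDiff ℝ m (halfVec k ε : QSpace n → Coeffs n) := by
  unfold halfVec
  exact (((contDiff_regInv hε).pow _).smul (contDiff_gradOp 0 contDiff_const)).const_smul _

lemma IsHomogeneous.gradOp {n p : ℕ} {v : Coeffs n} (hv : IsHomogeneous p v) (α : Fin 2)
    (q : QSpace n) : IsHomogeneous (p + 1) (gradOp α q v) := by
  unfold QuaternionicMA.gradOp
  rw [LinearMap.sum_apply]
  exact IsHomogeneous.sum fun i _ => (hv.wedgeLeft i).smul _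

lemma isHomogeneous_halfVec {n : ℕ} (k : ℕ) (ε : ℝ) (q : QSpace n) :
    IsHomogeneous (2 * k + 1) (halfVec k ε q) :=
  (((isHomogeneous_wedgeBeta_pow n k).gradOp 0 q).smul _).smul _

lemma isHomogeneous_powVec {n : ℕ} (k : ℕ) (ε : ℝ) (q : QSpace n) :
    IsHomogeneous (2 * k) (powVec k ε q) := by
  refine IsHomogeneous.smul ?_ _
  rw [sub_eq_add_neg, ← neg_smul]
  refine ((isHomogeneous_wedgeBeta_pow n k).smul _).add ?_
  cases k with
  | zero => intro K _; simp
  | succ k => exact (((isHomogeneous_wedgeBeta_pow n k).gradOp 1 q).gradOp 0 q).smul _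

lemma pairing_const_mul {n : ℕ} (m : Measure (QSpace n)) (a : ℂ) (c η : Form n) :
    pairing m (fun I q => a * c I q) η = a * pairing m c η := by
  simp only [pairing, mul_assoc, integral_const_mul, Finset.mul_sum]
  exact Finset.sum_congr rfl fun I _ => mul_left_comm _ _ _

/-- Integration by parts in degrees 2k and 2k+1 produces the signs -1 and +1; their product cancels
the minus sign of `dVec_one_halfVec`. -/
lemma pairing_regularised {n : ℕ} (k : ℕ) {ε : ℝ} (hε : 0 < ε) {η : Form n}
    (hη : IsTestForm η) :
    pairing volume (fun I q => -regInv ε q * powVec k ε q I) (baston η) =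
      pairing volume (fun I q => powVec (k + 1) ε q I) η := by
  have hc0 : ContDiff ℝ 1 fun q : QSpace n => (-regInv ε q) • powVec k ε q :=
    (contDiff_regInv hε).neg.smul (contDiff_powVec k hε)
  have hc1 : ContDiff ℝ 1 (halfVec k ε : QSpace n → Coeffs n) := contDiff_halfVec k hε
  have h1 := pairing_d 0 (p := 2 * k) (c := fun I q => ((-regInv ε q) • powVec k ε q) I)
    (η := d 1 η) (fun I => contDiff_pi.1 hc0 I)
    (fun q => (isHomogeneous_powVec k ε q).smul _) (fun I => ((hη.d 1) I).1.of_le (by norm_cast))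
    (fun I => ((hη.d 1) I).2)
  have h2 := pairing_d 1 (p := 2 * k + 1) (c := fun I q => halfVec k ε q I)
    (η := η) (fun I => contDiff_pi.1 hc1 I)
    (fun q => isHomogeneous_halfVec k ε q) (fun I => (hη I).1.of_le (by norm_cast))
    (fun I => (hη I).2)
  rw [d_eq_dVec 0 (fun q => (-regInv ε q) • powVec k ε q), dVec_zero_regInv_smul_powVec k hε] at h1
  rw [d_eq_dVec 1 (halfVec k ε), dVec_one_halfVec k hε] at h2
  have h3 := pairing_const_mul volume (-1) (fun I (q : QSpace n) => powVec (k + 1) ε q I) η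
  simp only [Pi.smul_apply, smul_eq_mul] at h1 h2
  unfold baston
  rw [h1, h2, h3, pow_succ, pow_mul]
  simp

/-- Every monomial of β^{n-1} omits one pair, which g_0 and g_1 must supply together. The
determinant of the l-th block is |x₀ + i x₁|² + |x₂ + i x₃|² = |q_l|². -/
lemma gradOp_mul_gradOp_top {n : ℕ} (q : QSpace n) :
    gradOp 0 q (gradOp 1 q ((wedgeBeta n ^ (n - 1)) (vac n))) =
      (((n - 1).factorial : ℂ) * (‖q‖ ^ 2 : ℝ)) • Pi.single Finset.univ 1 := by
  set w := (wedgeBeta n ^ (n - 1)) (vac n) with hw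
  have h0 (l : Fin n) (s t : Fin 2) (m : Fin n) (h : l ≠ m) :
      wedgeLeft (idx l s) (wedgeLeft (idx m t) w) = 0 := by
    rw [hw, ← Module.End.mul_apply, ← Module.End.mul_apply,
      wedgeLeft_wedgeLeft_wedgeBeta_pow_of_ne h, LinearMap.zero_apply]
  have hs (l : Fin n) (s : Fin 2) : wedgeLeft (idx l s) (wedgeLeft (idx l s) w) = 0 := by
    rw [← Module.End.mul_apply, wedgeLeft_mul_self, LinearMap.zero_apply]
  have h10 (l : Fin n) : wedgeLeft (idx l 1) (wedgeLeft (idx l 0) w) = (-1 : ℂ) • wedgePair l w := by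
    rw [← Module.End.mul_apply, wedgeLeft_anticomm]; rfl
  have h01 (l : Fin n) : wedgeLeft (idx l 0) (wedgeLeft (idx l 1) w) = wedgePair l w := rfl
  have h1 : gradOp 0 q (gradOp 1 q w) = ∑ l : Fin n,
      (halfGrad 0 (idx l 0) q * halfGrad 1 (idx l 1) q -
        halfGrad 0 (idx l 1) q * halfGrad 1 (idx l 0) q) • wedgePair l w := by
    have g1 : gradOp 1 q w = ∑ m : Fin n, (halfGrad 1 (idx m 0) q • wedgeLeft (idx m 0) w +
        halfGrad 1 (idx m 1) q • wedgeLeft (idx m 1) w) := by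
      simp only [gradOp, sum_idx, LinearMap.sum_apply, LinearMap.add_apply, LinearMap.smul_apply]
    rw [g1]
    simp only [gradOp, sum_idx, LinearMap.sum_apply]
    refine Finset.sum_congr rfl fun l _ => ?_
    rw [map_sum, Finset.sum_eq_single l _ (by simp)]
    · simp only [LinearMap.add_apply, LinearMap.smul_apply, map_add, map_smul, hs, h10, h01]
      module
    · intro m _ hm
      simp only [LinearMap.add_apply, LinearMap.smul_apply, map_add, map_smul, h0 l _ _ m hm.symm]
      simp
  rw [h1]
  simp only [hw, wedgePair_wedgeBeta_pow, smul_smul, ← Finset.sum_smul, ← Finset.sum_mul]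
  congr 1
  rw [mul_comm, EuclideanSpace.norm_sq_eq, Fintype.sum_prod_type]
  congr 1
  push_cast
  refine Finset.sum_congr rfl fun l _ => ?_
  obtain ⟨e1, e2, e3, e4⟩ := halfGrad_eq (n := n) l
  simp only [e1, e2, e3, e4, linForm, Fin.sum_univ_four, Real.norm_eq_abs, ← Complex.ofReal_pow,
    sq_abs]
  push_cast
  ring_nf
  simp only [Complex.I_sq]
  ring

/-- With s^{2n} = s^{2n+1}(‖q‖² + ε) the two terms containing ‖q‖² cancel. -/
lemma powVec_top {n : ℕ} (hn : 0 < n) {ε : ℝ} (hε : 0 < ε) (q : QSpace n) :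
    powVec n ε q = ((8 : ℂ) ^ n * n.factorial * ((ε * (‖q‖ ^ 2 + ε)⁻¹ ^ (2 * n + 1) : ℝ) : ℂ)) •
      Pi.single Finset.univ 1 := by
  have hpos : ‖q‖ ^ 2 + ε ≠ 0 := by positivity
  unfold powVec
  rw [gradOp_mul_gradOp_top, wedgeBeta_pow_top, smul_smul, smul_smul, ← sub_smul, smul_smul]
  congr 1
  have hf : (n.factorial : ℂ) = n * (n - 1).factorial := by
    exact_mod_cast (Nat.mul_factorial_pred hn.ne').symm
  have h1 : regInv ε q ^ (2 * n) = regInv ε q ^ (2 * n + 1) * ((‖q‖ ^ 2 + ε : ℝ) : ℂ) := by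
    rw [pow_succ, mul_assoc, regInv, ← Complex.ofReal_mul, inv_mul_cancel₀ hpos]
    simp
  have h2 : (((‖q‖ ^ 2 + ε)⁻¹ ^ (2 * n + 1) : ℝ) : ℂ) = regInv ε q ^ (2 * n + 1) :=
    Complex.ofReal_pow _ _
  rw [h1, hf, Complex.ofReal_mul, h2]
  push_cast
  ring

/-! ### Removing the regularisation -/

lemma finrank_qSpace (n : ℕ) : Module.finrank ℝ (QSpace n) = 4 * n := by
  simp [mul_comm]

lemma nontrivial_qSpace {n : ℕ} (hn : 0 < n) : Nontrivial (QSpace n) :=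
  Module.nontrivial_of_finrank_pos (R := ℝ) (by rw [finrank_qSpace]; omega)

lemma norm_linForm_le {n : ℕ} {c₁ c₂ : ℂ} (h₁ : ‖c₁‖ = 1) (h₂ : ‖c₂‖ = 1) (x y : Fin n × Fin 4)
    (q : QSpace n) : ‖linForm c₁ c₂ x y q‖ ≤ 2 * ‖q‖ := by
  refine (norm_add_le _ _).trans ?_
  rw [norm_mul, norm_mul, h₁, h₂, Complex.norm_real, Complex.norm_real]
  have hx := PiLp.norm_apply_le q x
  have hy := PiLp.norm_apply_le q y
  linarith

lemma norm_halfGrad_le {n : ℕ} (α : Fin 2) (j : Fin (n * 2)) (q : QSpace n) :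
    ‖halfGrad α j q‖ ≤ 2 * ‖q‖ := by
  obtain ⟨l, s, rfl⟩ : ∃ l s, j = idx l s := ⟨_, _, (idx_divNat_modNat j).symm⟩
  obtain ⟨h1, h2, h3, h4⟩ := halfGrad_eq (n := n) l
  fin_cases s <;> fin_cases α
  · exact h1 ▸ norm_linForm_le (by simp) (by simp) _ _ _
  · exact h2 ▸ norm_linForm_le (by simp) (by simp) _ _ _
  · exact h3 ▸ norm_linForm_le (by simp) (by simp) _ _ _
  · exact h4 ▸ norm_linForm_le (by simp) (by simp) _ _ _

lemma exists_norm_gradOp_gradOp_le {n : ℕ} (w : Coeffs n) (I : Finset (Fin (n * 2))) :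
    ∃ C, 0 ≤ C ∧ ∀ q : QSpace n, ‖gradOp 0 q (gradOp 1 q w) I‖ ≤ C * ‖q‖ ^ 2 := by
  refine ⟨∑ i, ∑ j, 4 * ‖wedgeLeft i (wedgeLeft j w) I‖, by positivity, fun q => ?_⟩
  have h : gradOp 0 q (gradOp 1 q w) I =
      ∑ i, ∑ j, halfGrad 0 i q * (halfGrad 1 j q * wedgeLeft i (wedgeLeft j w) I) := by
    simp only [gradOp, LinearMap.sum_apply, LinearMap.smul_apply, map_sum, map_smul,
      Finset.sum_apply, Pi.smul_apply, smul_eq_mul, Finset.mul_sum]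
    rw [Finset.sum_comm]
    exact Finset.sum_congr rfl fun i _ => Finset.sum_congr rfl fun j _ => mul_left_comm _ _ _
  rw [h, Finset.sum_mul]
  refine norm_sum_le_of_le _ fun i _ => ?_
  rw [Finset.sum_mul]
  refine norm_sum_le_of_le _ fun j _ => ?_
  rw [norm_mul, norm_mul]
  calc _ ≤ (2 * ‖q‖) * ((2 * ‖q‖) * ‖wedgeLeft i (wedgeLeft j w) I‖) := by
        gcongr <;> exact norm_halfGrad_le _ _ _
    _ = _ := by ring

lemma norm_regInv_le {n : ℕ} {ε : ℝ} (hε : 0 ≤ ε) {q : QSpace n} (hq : q ≠ 0) :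
    ‖regInv ε q‖ ≤ (‖q‖⁻¹) ^ 2 := by
  have : 0 < ‖q‖ := norm_pos_iff.2 hq
  rw [regInv, Complex.norm_real, Real.norm_of_nonneg (by positivity), inv_pow]
  gcongr
  linarith

/-- The quadratic growth of g_0 ∧ g_1 compensates for the extra factor s. The constant is
independent of ε, and ε = 0 is included. -/
lemma exists_norm_powVec_le {n : ℕ} (k : ℕ) (I : Finset (Fin (n * 2))) :
    ∃ C, 0 ≤ C ∧ ∀ ε, 0 ≤ ε → ∀ q : QSpace n, q ≠ 0 →
      ‖powVec k ε q I‖ ≤ C * (‖q‖⁻¹) ^ (4 * k) := by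
  obtain ⟨C, hC, h⟩ := exists_norm_gradOp_gradOp_le ((wedgeBeta n ^ (k - 1)) (vac n)) I
  refine ⟨8 ^ k * (‖(wedgeBeta n ^ k) (vac n) I‖ + k * C), by positivity, fun ε hε q hq => ?_⟩
  have hs := norm_regInv_le hε hq
  have hq' : ‖q‖ ≠ 0 := norm_ne_zero_iff.2 hq
  have e : powVec k ε q I = 8 ^ k * (regInv ε q ^ (2 * k) * (wedgeBeta n ^ k) (vac n) I -
      k * regInv ε q ^ (2 * k + 1) *
        gradOp 0 q (gradOp 1 q ((wedgeBeta n ^ (k - 1)) (vac n))) I) := rfl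
  rw [e, norm_mul, norm_pow, mul_assoc (8 ^ k), add_mul]
  simp only [Complex.norm_ofNat]
  refine mul_le_mul_of_nonneg_left ((norm_sub_le _ _).trans (add_le_add ?_ ?_)) (by positivity)
  · rw [norm_mul, norm_pow, mul_comm]
    calc _ ≤ ‖(wedgeBeta n ^ k) (vac n) I‖ * ((‖q‖⁻¹) ^ 2) ^ (2 * k) := by gcongr
      _ = _ := by rw [← pow_mul]; ring_nf
  · rw [norm_mul, norm_mul, norm_pow, Complex.norm_natCast]
    calc _ ≤ k * ((‖q‖⁻¹) ^ 2) ^ (2 * k + 1) * (C * ‖q‖ ^ 2) := by gcongr; exact h q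
      _ = k * C * ((‖q‖⁻¹) ^ (4 * k) * ((‖q‖⁻¹) ^ 2 * ‖q‖ ^ 2)) := by ring
      _ = _ := by rw [inv_pow ‖q‖ 2, inv_mul_cancel₀ (by positivity)]; ring

lemma measurable_regInv {n : ℕ} (ε : ℝ) : Measurable (regInv ε : QSpace n → ℂ) := by
  unfold regInv; fun_prop

lemma measurable_powVec {n : ℕ} (k : ℕ) (ε : ℝ) (I : Finset (Fin (n * 2))) :
    Measurable fun q : QSpace n => powVec k ε q I := by
  have h : Measurable fun q : QSpace n =>
      gradOp 0 q (gradOp 1 q ((wedgeBeta n ^ (k - 1)) (vac n))) I := by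
    have h1 : ContDiff ℝ 0 fun q : QSpace n =>
        gradOp 0 q (gradOp 1 q ((wedgeBeta n ^ (k - 1)) (vac n))) :=
      contDiff_gradOp 0 (contDiff_gradOp 1 contDiff_const)
    exact ((continuous_apply I).comp h1.continuous).measurable
  exact (((measurable_regInv ε).pow_const _).mul_const _ |>.sub
    ((((measurable_regInv ε).pow_const _).const_mul _).mul h)).const_mul _

lemma tendsto_regInv {n : ℕ} {q : QSpace n} (hq : q ≠ 0) :
    Tendsto (fun ε : ℝ => regInv ε q) (𝓝[>] 0) (𝓝 (regInv 0 q)) := by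
  have : ContinuousAt (fun ε : ℝ => regInv ε q) 0 := by
    unfold regInv
    have h : ‖q‖ ^ 2 + 0 ≠ 0 := by simpa using hq
    fun_prop (disch := exact h)
  exact this.tendsto.mono_left nhdsWithin_le_nhds

lemma tendsto_powVec {n : ℕ} (k : ℕ) {q : QSpace n} (hq : q ≠ 0) (I : Finset (Fin (n * 2))) :
    Tendsto (fun ε : ℝ => powVec k ε q I) (𝓝[>] 0) (𝓝 (powVec k 0 q I)) :=
  ((((tendsto_regInv hq).pow _).mul_const _).sub
    ((((tendsto_regInv hq).pow _).const_mul _).mul_const _)).const_mul _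

/-- In polar coordinates the radial density is r^{4n-1-p}, with a nonnegative exponent. -/
lemma locallyIntegrable_inv_norm_pow {n : ℕ} {p : ℕ} (hp : p < 4 * n) :
    LocallyIntegrable (fun q : QSpace n => (‖q‖⁻¹) ^ p) := by
  have := nontrivial_qSpace (n := n) (by omega)
  rw [locallyIntegrable_iff]
  intro K hK
  obtain ⟨r, hr⟩ := hK.isBounded.subset_ball (0 : QSpace n)
  refine IntegrableOn.mono_set ?_ hr
  rw [integrableOn_fun_norm_addHaar (E := QSpace n) volume (f := fun y => (y⁻¹) ^ p) (r := r),
    finrank_qSpace]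
  have hc : ContinuousOn (fun y : ℝ => y ^ (4 * n - 1 - p)) (Set.Icc 0 r) := by fun_prop
  refine ((hc.integrableOn_Icc).mono_set Set.Ioo_subset_Icc_self).congr_fun ?_ measurableSet_Ioo
  intro y hy
  have hy0 : y ≠ 0 := hy.1.ne'
  simp only [smul_eq_mul]
  have : y ^ (4 * n - 1) = y ^ (4 * n - 1 - p) * y ^ p := by rw [← pow_add]; congr 1; omega
  rw [this, mul_assoc, ← mul_pow, mul_inv_cancel₀ hy0, one_pow, mul_one]

lemma ae_ne_zero {n : ℕ} (hn : 0 < n) : ∀ᵐ q : QSpace n, q ≠ 0 := by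
  have := nontrivial_qSpace hn
  exact Measure.ae_ne volume 0

lemma locallyIntegrable_of_le_inv_norm_pow {n : ℕ} {p : ℕ} (hp : p < 4 * n) {f : QSpace n → ℂ}
    (hf : Measurable f) {C : ℝ} (hC : ∀ q, q ≠ 0 → ‖f q‖ ≤ C * (‖q‖⁻¹) ^ p) :
    LocallyIntegrable f := by
  have h := (locallyIntegrable_inv_norm_pow hp).smul C
  refine h.mono hf.aestronglyMeasurable ?_
  filter_upwards [ae_ne_zero (n := n) (by omega)] with q hq
  exact (hC q hq).trans (le_abs_self _)

lemma tendsto_pairing {n : ℕ} {p : ℕ} (hp : p < 4 * n) {c : ℝ → Form n}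
    (hm : ∀ ε I, Measurable (c ε I))
    (hC : ∀ I, ∃ C, ∀ ε, 0 ≤ ε → ∀ q, q ≠ 0 → ‖c ε I q‖ ≤ C * (‖q‖⁻¹) ^ p)
    (hl : ∀ I q, q ≠ 0 → Tendsto (fun ε => c ε I q) (𝓝[>] 0) (𝓝 (c 0 I q)))
    {η : Form n} (hη : IsTestForm η) :
    Tendsto (fun ε => pairing volume (c ε) η) (𝓝[>] 0) (𝓝 (pairing volume (c 0) η)) := by
  refine tendsto_finsetSum _ fun I _ => Tendsto.const_mul _ ?_
  obtain ⟨C, hC⟩ := hC I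
  have hη' := (hη Iᶜ).1.continuous
  refine tendsto_integral_filter_of_dominated_convergence
    (fun q => C * ((‖q‖⁻¹) ^ p * ‖η Iᶜ q‖)) ?_ ?_ ?_ ?_
  · exact Eventually.of_forall fun ε => ((hm ε I).mul hη'.measurable).aestronglyMeasurable
  · filter_upwards [self_mem_nhdsWithin] with ε hε
    filter_upwards [ae_ne_zero (n := n) (by omega)] with q hq
    rw [norm_mul, ← mul_assoc]
    gcongr
    exact hC ε (le_of_lt hε) q hq
  · exact ((locallyIntegrable_inv_norm_pow hp).integrable_smul_right_of_hasCompactSupport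
      hη'.norm (hη Iᶜ).2.norm).const_mul C
  · filter_upwards [ae_ne_zero (n := n) (by omega)] with q hq
    exact (hl I q hq).mul_const _

lemma tendsto_pairing_powVec {n k : ℕ} (hk : k < n) {η : Form n} (hη : IsTestForm η) :
    Tendsto (fun ε => pairing volume (fun I q => powVec k ε q I) η) (𝓝[>] 0)
      (𝓝 (pairing volume (fun I q => powVec k 0 q I) η)) := by
  refine tendsto_pairing (p := 4 * k) (by omega) (c := fun ε I q => powVec k ε q I)
    (fun ε I => measurable_powVec k ε I) (fun I => ?_) (fun I q hq => tendsto_powVec k hq I) hη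
  obtain ⟨C, -, h⟩ := exists_norm_powVec_le (n := n) k I
  exact ⟨C, h⟩

lemma exists_norm_regInv_mul_powVec_le {n : ℕ} (k : ℕ) (I : Finset (Fin (n * 2))) :
    ∃ C, ∀ ε, 0 ≤ ε → ∀ q : QSpace n, q ≠ 0 →
      ‖-regInv ε q * powVec k ε q I‖ ≤ C * (‖q‖⁻¹) ^ (4 * k + 2) := by
  obtain ⟨C, hC, h⟩ := exists_norm_powVec_le (n := n) k I
  refine ⟨C, fun ε hε q hq => ?_⟩
  rw [norm_mul, norm_neg]
  calc _ ≤ (‖q‖⁻¹) ^ 2 * (C * (‖q‖⁻¹) ^ (4 * k)) := by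
        gcongr
        · exact norm_regInv_le hε hq
        · exact h ε hε q hq
    _ = _ := by ring

lemma tendsto_pairing_regInv_mul_powVec {n k : ℕ} (hk : k < n) {η : Form n}
    (hη : IsTestForm η) :
    Tendsto (fun ε => pairing volume (fun I q => -regInv ε q * powVec k ε q I) η) (𝓝[>] 0)
      (𝓝 (pairing volume (fun I q => -regInv 0 q * powVec k 0 q I) η)) :=
  tendsto_pairing (p := 4 * k + 2) (by omega) (c := fun ε I q => -regInv ε q * powVec k ε q I)
    (fun ε I => (measurable_regInv ε).neg.mul (measurable_powVec k ε I))
    (exists_norm_regInv_mul_powVec_le k)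
    (fun I q hq => (tendsto_regInv hq).neg.mul (tendsto_powVec k hq I)) hη

/-- The limit ε → 0 of `pairing_regularised`; as k + 1 < n, both sides converge by domination. -/
lemma pairing_powVec_succ {n k : ℕ} (hk : k + 1 < n) {η : Form n} (hη : IsTestForm η) :
    pairing volume (fun I q => powVec (k + 1) 0 q I) η =
      pairing volume (fun I q => -regInv 0 q * powVec k 0 q I) (baston η) := by
  refine tendsto_nhds_unique (tendsto_pairing_powVec hk hη)
    ((tendsto_pairing_regInv_mul_powVec (by omega) hη.baston).congr' ?_)
  filter_upwards [self_mem_nhdsWithin] with ε hε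
  exact pairing_regularised k hε hη

/-! ### The point mass -/

lemma integrable_inv_one_add_norm_sq_pow (n : ℕ) :
    Integrable fun q : QSpace n => (1 + ‖q‖ ^ 2)⁻¹ ^ (2 * n + 1) := by
  have h := integrable_rpow_neg_one_add_norm_sq (E := QSpace n) (μ := volume) (r := 4 * n + 2)
    (by rw [finrank_qSpace]; push_cast; linarith)
  refine h.congr (Eventually.of_forall fun q => ?_)
  have : -(4 * (n : ℝ) + 2) / 2 = -((2 * n + 1 : ℕ) : ℝ) := by push_cast; ring
  simp only [this]
  rw [Real.rpow_neg (by positivity), Real.rpow_natCast, inv_pow]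

lemma measureReal_unitBall {n : ℕ} (hn : 0 < n) :
    (volume : Measure (QSpace n)).real (Metric.ball 0 1) =
      Real.pi ^ (2 * n) / (2 * n).factorial := by
  have : Nonempty (Fin n × Fin 4) := ⟨⟨0, hn⟩, 0⟩
  rw [Measure.real, EuclideanSpace.volume_ball]
  have h1 : Fintype.card (Fin n × Fin 4) = 2 * (2 * n) := by simp; ring
  have h2 : ((2 * (2 * n) : ℕ) : ℝ) / 2 + 1 = ((2 * n : ℕ) : ℝ) + 1 := by push_cast; ring
  rw [h1, h2, Real.Gamma_nat_eq_factorial, pow_mul (√Real.pi), Real.sq_sqrt Real.pi_pos.le]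
  simp only [ENNReal.ofReal_one, one_pow, one_mul]
  rw [ENNReal.toReal_ofReal (by positivity)]

lemma integral_inv_one_add_norm_sq_pow {n : ℕ} (hn : 0 < n) :
    ∫ q : QSpace n, (1 + ‖q‖ ^ 2)⁻¹ ^ (2 * n + 1) = Real.pi ^ (2 * n) / (2 * n).factorial := by
  have := nontrivial_qSpace hn
  have hi := integrable_inv_one_add_norm_sq_pow n
  rw [integrable_fun_norm_addHaar (E := QSpace n) volume
    (f := fun y => (1 + y ^ 2)⁻¹ ^ (2 * n + 1))] at hi
  rw [integral_fun_norm_addHaar (E := QSpace n) volume (fun y => (1 + y ^ 2)⁻¹ ^ (2 * n + 1)),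
    measureReal_unitBall hn]
  rw [finrank_qSpace] at hi ⊢
  have hn' : (n : ℝ) ≠ 0 := by positivity
  -- With w = y²/(1+y²) and w' = 2y/(1+y²)², the function w^{2n}/(4n) is a primitive of the radial
  -- density. It tends to 1/(4n), so the integral is the volume of the unit ball.
  have hd (x : ℝ) : HasDerivAt (fun y : ℝ => (y ^ 2 * (1 + y ^ 2)⁻¹) ^ (2 * n) / (4 * n))
      (x ^ (4 * n - 1) • (1 + x ^ 2)⁻¹ ^ (2 * n + 1)) x := by
    have hx : 1 + x ^ 2 ≠ 0 := by positivity
    have h1 : HasDerivAt (fun y : ℝ => y ^ 2) (2 * x) x := by simpa using hasDerivAt_pow 2 x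
    refine ((((h1.fun_mul ((h1.const_add 1).fun_inv hx)).fun_pow (2 * n)).div_const _)).congr_deriv ?_
    obtain ⟨m, rfl⟩ : ∃ m, n = m + 1 := ⟨n - 1, by omega⟩
    have e1 : 4 * (m + 1) - 1 = 2 * (2 * m + 1) + 1 := by omega
    have e2 : 2 * (m + 1) - 1 = 2 * m + 1 := by omega
    have e3 : 2 * (m + 1) + 1 = 2 * m + 1 + 2 := by omega
    rw [e1, e2, e3, smul_eq_mul, pow_add (1 + x ^ 2)⁻¹, mul_pow, ← pow_mul, pow_succ x]
    push_cast
    field_simp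
    ring
  have hlim : Tendsto (fun y : ℝ => (y ^ 2 * (1 + y ^ 2)⁻¹) ^ (2 * n) / (4 * n)) atTop
      (𝓝 (1 / (4 * n : ℝ))) := by
    have h1 : Tendsto (fun y : ℝ => 1 - (1 + y ^ 2)⁻¹) atTop (𝓝 (1 - 0)) :=
      tendsto_const_nhds.sub (tendsto_inv_atTop_zero.comp
        (tendsto_atTop_add_const_left _ _ (tendsto_pow_atTop two_ne_zero)))
    have h2 := (h1.pow (2 * n)).div_const (4 * n : ℝ)
    simp only [sub_zero, one_pow] at h2
    refine h2.congr fun y => ?_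
    have : 1 + y ^ 2 ≠ 0 := by positivity
    congr 2
    field_simp
    ring
  rw [integral_Ioi_of_hasDerivAt_of_tendsto (hd 0).continuousAt.continuousWithinAt
    (fun x _ => hd x) hi hlim]
  have : (2 * n) ≠ 0 := by omega
  simp only [nsmul_eq_mul, smul_eq_mul]
  push_cast
  simp [this]
  field_simp

/-- Substitute √ε q for q: the Jacobian ε^{2n} cancels ε · ε^{-(2n+1)}. -/
lemma integral_regularised_delta {n : ℕ} {ε : ℝ} (hε : 0 < ε) (g : QSpace n → ℂ) :
    ∫ q, ((ε * (‖q‖ ^ 2 + ε)⁻¹ ^ (2 * n + 1) : ℝ) : ℂ) * g q =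
      ∫ q, (((1 + ‖q‖ ^ 2)⁻¹ ^ (2 * n + 1) : ℝ) : ℂ) * g (√ε • q) := by
  have h := Measure.integral_comp_smul (volume : Measure (QSpace n))
    (fun q => ((ε * (‖q‖ ^ 2 + ε)⁻¹ ^ (2 * n + 1) : ℝ) : ℂ) * g q) (√ε)
  have hs : √ε ^ (4 * n) = ε ^ (2 * n) := by
    rw [show 4 * n = 2 * (2 * n) by ring, pow_mul, Real.sq_sqrt hε.le]
  rw [finrank_qSpace, hs, abs_of_nonneg (by positivity)] at h
  have h2 : ∫ q, ((ε * (‖q‖ ^ 2 + ε)⁻¹ ^ (2 * n + 1) : ℝ) : ℂ) * g q = (ε ^ (2 * n)) •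
      ∫ q : QSpace n, ((ε * (‖√ε • q‖ ^ 2 + ε)⁻¹ ^ (2 * n + 1) : ℝ) : ℂ) * g (√ε • q) := by
    rw [h, smul_smul, mul_inv_cancel₀ (by positivity), one_smul]
  rw [h2, ← integral_smul]
  refine integral_congr_ae (Eventually.of_forall fun q => ?_)
  simp only
  rw [norm_smul, Real.norm_of_nonneg (Real.sqrt_nonneg _), mul_pow, Real.sq_sqrt hε.le,
    Complex.real_smul, ← mul_assoc, ← Complex.ofReal_mul]
  congr 2
  have h3 : ε * ‖q‖ ^ 2 + ε = ε * (1 + ‖q‖ ^ 2) := by ring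
  rw [h3, mul_inv, mul_pow]
  have : ε ^ (2 * n) * (ε * (ε⁻¹ ^ (2 * n + 1))) = 1 := by
    rw [← mul_assoc, ← pow_succ, ← mul_pow, mul_inv_cancel₀ hε.ne', one_pow]
  linear_combination ((1 + ‖q‖ ^ 2)⁻¹ ^ (2 * n + 1)) * this

lemma tendsto_integral_regularised_delta {n : ℕ} (hn : 0 < n) {g : QSpace n → ℂ}
    (hg : Continuous g) (hs : HasCompactSupport g) :
    Tendsto (fun ε : ℝ => ∫ q, ((ε * (‖q‖ ^ 2 + ε)⁻¹ ^ (2 * n + 1) : ℝ) : ℂ) * g q) (𝓝[>] 0)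
      (𝓝 ((Real.pi ^ (2 * n) / (2 * n).factorial : ℝ) * g 0)) := by
  obtain ⟨C, hC⟩ := hs.exists_bound_of_continuous hg
  have h1 : Tendsto (fun ε : ℝ => ∫ q : QSpace n,
      (((1 + ‖q‖ ^ 2)⁻¹ ^ (2 * n + 1) : ℝ) : ℂ) * g (√ε • q)) (𝓝[>] 0)
      (𝓝 (∫ q : QSpace n, (((1 + ‖q‖ ^ 2)⁻¹ ^ (2 * n + 1) : ℝ) : ℂ) * g 0)) := by
    have hpos (q : QSpace n) : 1 + ‖q‖ ^ 2 ≠ 0 := by positivity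
    refine tendsto_integral_filter_of_dominated_convergence
      (fun q => (1 + ‖q‖ ^ 2)⁻¹ ^ (2 * n + 1) * C) ?_ ?_ ?_ ?_
    · refine Eventually.of_forall fun ε => Continuous.aestronglyMeasurable ?_
      exact (Complex.continuous_ofReal.comp (((by fun_prop : Continuous fun q : QSpace n =>
        1 + ‖q‖ ^ 2).inv₀ hpos).pow _)).mul (hg.comp (by fun_prop))
    · refine Eventually.of_forall fun ε => Eventually.of_forall fun q => ?_
      rw [norm_mul, Complex.norm_real, Real.norm_of_nonneg (by positivity)]
      gcongr
      exact hC _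
    · exact (integrable_inv_one_add_norm_sq_pow n).mul_const C
    · refine Eventually.of_forall fun q => Tendsto.const_mul _ ?_
      have : ContinuousAt (fun ε : ℝ => g (√ε • q)) 0 := by fun_prop
      simpa using this.tendsto.mono_left nhdsWithin_le_nhds
  rw [integral_mul_const, integral_complex_ofReal, integral_inv_one_add_norm_sq_pow hn] at h1
  refine h1.congr' ?_
  filter_upwards [self_mem_nhdsWithin] with ε hε
  exact (integral_regularised_delta hε g).symm

/-- The total mass of the Monge-Ampère measure of `-1 / ‖q‖²`. -/
def maMass (n : ℕ) : ℝ := 8 ^ n * (n.factorial : ℝ) * Real.pi ^ (2 * n) / ((2 * n).factorial : ℝ)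

lemma wedgeSign_univ (n : ℕ) : wedgeSign (Finset.univ : Finset (Fin (n * 2))) = 1 := by
  simp [wedgeSign]

lemma wedgeSign_empty (n : ℕ) : wedgeSign (∅ : Finset (Fin (n * 2))) = 1 := by
  simp [wedgeSign]

lemma tendsto_pairing_powVec_top {n : ℕ} (hn : 0 < n) {η : Form n} (hη : IsTestForm η) :
    Tendsto (fun ε => pairing volume (fun I q => powVec n ε q I) η) (𝓝[>] 0)
      (𝓝 (maMass n * η ∅ 0)) := by
  have h := (tendsto_integral_regularised_delta hn (hη ∅).1.continuous (hη ∅).2).const_mul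
    ((8 : ℂ) ^ n * n.factorial)
  have e : (8 : ℂ) ^ n * n.factorial * ((Real.pi ^ (2 * n) / (2 * n).factorial : ℝ) * η ∅ 0) =
      maMass n * η ∅ 0 := by
    rw [maMass]; push_cast; ring
  rw [e] at h
  refine h.congr' ?_
  filter_upwards [self_mem_nhdsWithin] with ε hε
  unfold pairing
  rw [Finset.sum_eq_single Finset.univ]
  · rw [wedgeSign_univ, one_mul, Finset.compl_univ, ← integral_const_mul]
    refine integral_congr_ae (Eventually.of_forall fun q => ?_)
    simp only [powVec_top hn hε]
    simp [mul_assoc]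
  · intro I _ hI
    simp only [powVec_top hn hε]
    simp [hI]
  · simp

/-- The critical degree: u(△u)^{n-1} is still locally integrable, of order ‖q‖^{-(4n-2)}, but the
other side of the regularised identity concentrates at the origin. -/
lemma pairing_regInv_mul_powVec_top {n k : ℕ} (hk : k + 1 = n) {η : Form n} (hη : IsTestForm η) :
    pairing volume (fun I q => -regInv 0 q * powVec k 0 q I) (baston η) = maMass n * η ∅ 0 := by
  subst hk
  refine tendsto_nhds_unique ((tendsto_pairing_regInv_mul_powVec (by omega) hη.baston).congr' ?_)
    (tendsto_pairing_powVec_top (by omega) hη)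
  filter_upwards [self_mem_nhdsWithin] with ε hε
  exact pairing_regularised k hε hη

/-! ### Uniqueness -/

lemma locallyIntegrable_rnDeriv_smul {n : ℕ} {m M : Measure (QSpace n)} [SigmaFinite m]
    [SigmaFinite M] (h : m ≪ M) {c : QSpace n → ℂ} (hc : LocallyIntegrable c m) :
    LocallyIntegrable (fun q => (m.rnDeriv M q).toReal • c q) M := by
  rw [locallyIntegrable_iff] at hc ⊢
  intro K hK
  have h1 := hc K hK
  rw [← integrable_indicator_iff hK.measurableSet, ← integrable_rnDeriv_smul_iff h] at h1
  rw [← integrable_indicator_iff hK.measurableSet]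
  refine h1.congr (Eventually.of_forall fun q => ?_)
  by_cases hq : q ∈ K <;> simp [hq]

/-- Two complex Radon measures which agree on test functions have the same density with respect
to a common base. -/
lemma ae_eq_of_integral_test_eq {n : ℕ} {m m' : Measure (QSpace n)} [SigmaFinite m]
    [SigmaFinite m'] {c c' : QSpace n → ℂ} (hc : LocallyIntegrable c m)
    (hc' : LocallyIntegrable c' m')
    (h : ∀ g : QSpace n → ℝ, ContDiff ℝ ((⊤ : ℕ∞) : WithTop ℕ∞) g → HasCompactSupport g →
      ∫ q, g q • c q ∂m = ∫ q, g q • c' q ∂m') :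
    ∀ᵐ q ∂(m + m'), (m.rnDeriv (m + m') q).toReal • c q =
      (m'.rnDeriv (m + m') q).toReal • c' q := by
  have h1 : m ≪ m + m' := Measure.absolutelyContinuous_of_le (Measure.le_add_right le_rfl)
  have h2 : m' ≪ m + m' := Measure.absolutelyContinuous_of_le (Measure.le_add_left le_rfl)
  refine ae_eq_of_integral_contDiff_smul_eq (locallyIntegrable_rnDeriv_smul h1 hc)
    (locallyIntegrable_rnDeriv_smul h2 hc') fun g hg hs => ?_
  simp only [smul_comm (g _) (ENNReal.toReal _)]
  rw [integral_rnDeriv_smul h1, integral_rnDeriv_smul h2, h g hg hs]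

/-- The form `g ω^J`. -/
def singleForm {n : ℕ} (J : Finset (Fin (n * 2))) (g : QSpace n → ℂ) : Form n :=
  fun I => if I = J then g else 0

lemma isTestForm_singleForm {n : ℕ} (J : Finset (Fin (n * 2))) {g : QSpace n → ℝ}
    (hg : ContDiff ℝ ((⊤ : ℕ∞) : WithTop ℕ∞) g) (hs : HasCompactSupport g) :
    IsTestForm (singleForm J fun q => (g q : ℂ)) := by
  intro I
  unfold singleForm
  split_ifs with h
  · exact ⟨Complex.ofRealCLM.contDiff.comp hg, hs.comp_left (g := Complex.ofReal) (by simp)⟩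
  · exact ⟨contDiff_const, HasCompactSupport.zero⟩

lemma pairing_singleForm {n : ℕ} (m : Measure (QSpace n)) (c : Form n)
    (I : Finset (Fin (n * 2))) (g : QSpace n → ℂ) :
    pairing m c (singleForm Iᶜ g) = wedgeSign I * ∫ q, c I q * g q ∂m := by
  unfold pairing
  rw [Finset.sum_eq_single I]
  · simp [singleForm]
  · intro J _ hJ
    simp [singleForm, hJ]
  · simp

lemma wedgeSign_ne_zero {n : ℕ} (I : Finset (Fin (n * 2))) : wedgeSign I ≠ 0 :=
  pow_ne_zero _ (by simp)

/-- Base and coefficients are not unique, but the density of each T_I with respect to the sum of the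
two bases is, almost everywhere. Multiplication by u preserves this equality. -/
lemma RadonCurrent.mulApply_eq_of_apply_eq {n : ℕ} {T T' : RadonCurrent n}
    (h : ∀ η : Form n, IsTestForm η → T.apply η = T'.apply η) (u : QSpace n → EReal)
    (η : Form n) : T.mulApply u η = T'.mulApply u η := by
  have := T.locallyFinite
  have := T'.locallyFinite
  have h1 : T.base ≪ T.base + T'.base :=
    Measure.absolutelyContinuous_of_le (Measure.le_add_right le_rfl)
  have h2 : T'.base ≪ T.base + T'.base :=
    Measure.absolutelyContinuous_of_le (Measure.le_add_left le_rfl)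
  unfold RadonCurrent.mulApply pairing
  refine Finset.sum_congr rfl fun I _ => ?_
  congr 1
  have hae := ae_eq_of_integral_test_eq (T.locallyIntegrable I) (T'.locallyIntegrable I)
    fun g hg hs => by
      have := h _ (isTestForm_singleForm Iᶜ hg hs)
      unfold RadonCurrent.apply at this
      rw [pairing_singleForm, pairing_singleForm] at this
      simpa [mul_comm] using mul_left_cancel₀ (wedgeSign_ne_zero I) this
  rw [← integral_rnDeriv_smul h1, ← integral_rnDeriv_smul h2]
  refine integral_congr_ae ?_
  filter_upwards [hae] with q hq
  rw [mul_assoc, mul_assoc, mul_left_comm, mul_left_comm _ (T'.coeff I q), ← smul_mul_assoc, hq,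
    smul_mul_assoc]

lemma IsBastonPower.apply_eq {n : ℕ} {u : QSpace n → EReal} {k : ℕ} {T T' : RadonCurrent n}
    (hT : IsBastonPower u k T) (hT' : IsBastonPower u k T') {η : Form n} (hη : IsTestForm η) :
    T.apply η = T'.apply η := by
  induction k generalizing T T' η with
  | zero => exact (hT η hη).trans (hT' η hη).symm
  | succ k ih =>
    obtain ⟨S, hS, hST⟩ := hT
    obtain ⟨S', hS', hST'⟩ := hT'
    rw [hST.2 η hη, hST'.2 η hη]
    exact RadonCurrent.mulApply_eq_of_apply_eq (fun _ h => ih hS hS' h) u _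

lemma measure_eq_of_integral_test_eq {n : ℕ} {μ ν : Measure (QSpace n)}
    [IsLocallyFiniteMeasure μ] [IsLocallyFiniteMeasure ν]
    (h : ∀ η : Form n, IsTestForm η → ∫ q, η ∅ q ∂μ = ∫ q, η ∅ q ∂ν) : μ = ν := by
  have h1 : μ ≪ μ + ν := Measure.absolutelyContinuous_of_le (Measure.le_add_right le_rfl)
  have h2 : ν ≪ μ + ν := Measure.absolutelyContinuous_of_le (Measure.le_add_left le_rfl)
  have hae := ae_eq_of_integral_test_eq (m := μ) (m' := ν) (c := fun _ => (1 : ℂ))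
    (c' := fun _ => (1 : ℂ)) (locallyIntegrable_const 1) (locallyIntegrable_const 1)
    fun g hg hs => by
      have h3 := h _ (isTestForm_singleForm ∅ hg hs)
      simp only [singleForm, if_true] at h3
      simp only [Complex.real_smul, mul_one]
      exact h3
  refine (Measure.withDensity_rnDeriv_eq _ _ h1).symm.trans
    (Eq.trans (withDensity_congr_ae ?_) (Measure.withDensity_rnDeriv_eq _ _ h2))
  filter_upwards [hae, μ.rnDeriv_ne_top (μ + ν), ν.rnDeriv_ne_top (μ + ν)] with q hq hμ hν
  rw [← ENNReal.toReal_eq_toReal_iff' hμ hν]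
  rw [Complex.real_smul, Complex.real_smul, mul_one, mul_one] at hq
  exact Complex.ofReal_injective hq

/-! ### The Monge-Ampère measure -/

/-- At the origin both sides are 0, by the conventions for `toReal ⊥` and 0⁻¹. -/
lemma toReal_negInvNormSq {n : ℕ} (q : QSpace n) :
    ((negInvNormSq n q).toReal : ℂ) = -regInv 0 q := by
  unfold negInvNormSq regInv
  split_ifs with h
  · simp [h]
  · simp [neg_div]

/-- The current `(△u)^k`, `k < n`, for `u = -1 / ‖q‖²`. -/
def powCurrent {n k : ℕ} (hk : k < n) : RadonCurrent n where
  base := volume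
  coeff I q := powVec k 0 q I
  locallyFinite := inferInstance
  locallyIntegrable I := by
    obtain ⟨C, -, h⟩ := exists_norm_powVec_le (n := n) k I
    exact locallyIntegrable_of_le_inv_norm_pow (p := 4 * k) (by omega) (measurable_powVec k 0 I)
      (h 0 le_rfl)

/-- The current `c δ₀ ω^0 ∧ … ∧ ω^{2n-1}`. -/
def diracCurrent (n : ℕ) (c : ℂ) : RadonCurrent n where
  base := Measure.dirac 0
  coeff I _ := if I = Finset.univ then c else 0
  locallyFinite := inferInstance
  locallyIntegrable _ := locallyIntegrable_const _

lemma diracCurrent_apply {n : ℕ} (c : ℂ) (η : Form n) :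
    (diracCurrent n c).apply η = c * η ∅ 0 := by
  unfold RadonCurrent.apply pairing
  rw [Finset.sum_eq_single Finset.univ]
  · simp [diracCurrent, wedgeSign_univ]
  · intro I _ hI
    simp [diracCurrent, hI]
  · simp

lemma powCurrent_integrates {n k : ℕ} (hk : k < n) :
    (powCurrent hk).Integrates (negInvNormSq n) := by
  intro I
  constructor
  · filter_upwards [ae_ne_zero (n := n) (by omega)] with q hq h
    simp [negInvNormSq, hq] at h
  · simp only [toReal_negInvNormSq]
    obtain ⟨C, h⟩ := exists_norm_regInv_mul_powVec_le (n := n) k I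
    exact locallyIntegrable_of_le_inv_norm_pow (p := 4 * k + 2) (by omega)
      ((measurable_regInv 0).neg.mul (measurable_powVec k 0 I)) (h 0 le_rfl)

lemma powCurrent_mulApply {n k : ℕ} (hk : k < n) (η : Form n) :
    (powCurrent hk).mulApply (negInvNormSq n) η =
      pairing volume (fun I q => -regInv 0 q * powVec k 0 q I) η := by
  unfold RadonCurrent.mulApply
  simp only [toReal_negInvNormSq]
  rfl

lemma isBastonPower_powCurrent {n k : ℕ} (hk : k < n) :
    IsBastonPower (negInvNormSq n) k (powCurrent hk) := by
  induction k with
  | zero =>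
    intro η _
    unfold RadonCurrent.apply pairing
    have h (I : Finset (Fin (n * 2))) (q : QSpace n) :
        (powCurrent hk).coeff I q = if I = ∅ then 1 else 0 := by
      simp [powCurrent, powVec, Pi.single_apply]
    rw [Finset.sum_eq_single ∅]
    · simp only [h, wedgeSign_empty, Finset.compl_empty, if_true, one_mul]
      rfl
    · intro I _ hI
      simp [h, hI]
    · simp
  | succ k ih =>
    refine ⟨powCurrent (by omega), ih _, powCurrent_integrates _, fun η hη => ?_⟩
    rw [powCurrent_mulApply]
    exact pairing_powVec_succ hk hη

lemma isBastonPower_diracCurrent {n : ℕ} (hn : 0 < n) :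
    IsBastonPower (negInvNormSq n) n (diracCurrent n (maMass n)) := by
  obtain ⟨k, rfl⟩ : ∃ k, n = k + 1 := ⟨n - 1, by omega⟩
  refine ⟨powCurrent (Nat.lt_succ_self k), isBastonPower_powCurrent _, powCurrent_integrates _,
    fun η hη => ?_⟩
  rw [powCurrent_mulApply, diracCurrent_apply, pairing_regInv_mul_powVec_top rfl hη]

lemma integral_maMass_dirac {n : ℕ} (f : QSpace n → ℂ) :
    ∫ q, f q ∂(ENNReal.ofReal (maMass n) • Measure.dirac (0 : QSpace n)) = maMass n * f 0 := by
  have : 0 ≤ maMass n := by unfold maMass; positivity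
  rw [integral_smul_measure, integral_dirac, ENNReal.toReal_ofReal this, Complex.real_smul]

lemma isMongeAmpereMeasure_iff {n : ℕ} (hn : 0 < n) (μ : Measure (QSpace n)) :
    IsMongeAmpereMeasure (negInvNormSq n) μ ↔
      μ = ENNReal.ofReal (maMass n) • Measure.dirac 0 := by
  have hf : IsLocallyFiniteMeasure (ENNReal.ofReal (maMass n) • Measure.dirac (0 : QSpace n)) := by
    have : IsFiniteMeasure (ENNReal.ofReal (maMass n) • Measure.dirac (0 : QSpace n)) :=
      Measure.smul_finite _ ENNReal.ofReal_ne_top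
    infer_instance
  constructor
  · rintro ⟨hμ, T, hT, h⟩
    refine measure_eq_of_integral_test_eq fun η hη => ?_
    rw [← h η hη, hT.apply_eq (isBastonPower_diracCurrent hn) hη, diracCurrent_apply,
      integral_maMass_dirac]
  · rintro rfl
    refine ⟨hf, _, isBastonPower_diracCurrent hn, fun η _ => ?_⟩
    rw [diracCurrent_apply, integral_maMass_dirac]

/-! ### Integrals over the unit sphere -/

lemma lintegral_polar {E : Type*} [NormedAddCommGroup E] [NormedSpace ℝ E] [FiniteDimensional ℝ E]
    [MeasurableSpace E] [BorelSpace E] [Nontrivial E] (μ : Measure E) [μ.IsAddHaarMeasure]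
    {F : E → ENNReal} (hF : Measurable F) {h : ℝ → ENNReal} (hh : Measurable h) :
    ∫⁻ x, F (‖x‖⁻¹ • x) * h ‖x‖ ∂μ = (∫⁻ ω, F ω.1 ∂μ.toSphere) *
      ∫⁻ r in Set.Ioi 0, ENNReal.ofReal (r ^ (Module.finrank ℝ E - 1)) * h r := by
  calc ∫⁻ x, F (‖x‖⁻¹ • x) * h ‖x‖ ∂μ
      = ∫⁻ x : ({0}ᶜ : Set E), F (‖x.1‖⁻¹ • x.1) * h ‖x.1‖ ∂(μ.comap (↑)) := by
        rw [lintegral_subtype_comap (measurableSet_singleton _).compl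
          (fun x => F (‖x‖⁻¹ • x) * h ‖x‖), restrict_compl_singleton]
    _ = ∫⁻ y, F y.1.1 * h y.2.1
          ∂μ.toSphere.prod (Measure.volumeIoiPow (Module.finrank ℝ E - 1)) := by
        rw [← μ.measurePreserving_homeomorphUnitSphereProd.lintegral_comp_emb
          (Homeomorph.measurableEmbedding _)]
        simp
    _ = (∫⁻ ω, F ω.1 ∂μ.toSphere) *
          ∫⁻ r : Set.Ioi (0 : ℝ), h r ∂Measure.volumeIoiPow (Module.finrank ℝ E - 1) :=
        lintegral_prod_mul (hF.comp measurable_subtype_coe).aemeasurable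
          (hh.comp measurable_subtype_coe).aemeasurable
    _ = _ := by
        congr 1
        rw [Measure.volumeIoiPow, lintegral_withDensity_eq_lintegral_mul _ (by fun_prop)
          (g := fun r : Set.Ioi (0 : ℝ) => h r) (hh.comp measurable_subtype_coe)]
        exact lintegral_subtype_comap measurableSet_Ioi
          (fun r : ℝ => ENNReal.ofReal (r ^ (Module.finrank ℝ E - 1)) * h r)

/-- Slicing `ℝ⁴` along the first coordinate. -/
lemma exists_lintegral_slice : ∃ K : ENNReal, ∀ G : ℝ × ℝ → ENNReal, Measurable G →
    ∫⁻ x : EuclideanSpace ℝ (Fin 4), G (x 0, ‖x‖) =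
      K * ∫⁻ a : ℝ, ∫⁻ ρ in Set.Ioi (0 : ℝ),
        ENNReal.ofReal (ρ ^ 2) * G (a, √(a ^ 2 + ρ ^ 2)) := by
  -- The constant is the area of the unit sphere in ℝ³.
  refine ⟨(volume : Measure (EuclideanSpace ℝ (Fin 3))).toSphere Set.univ, fun G hG => ?_⟩
  have hmp := (volume_preserving_piFinSuccAbove (fun _ : Fin 4 => ℝ) 0).comp
    (EuclideanSpace.volume_preserving_symm_measurableEquiv_toLp (Fin 4))
  let H : ℝ × (Fin 3 → ℝ) → ENNReal := fun p =>
    G (p.1, √(p.1 ^ 2 + ‖(WithLp.toLp 2 p.2 : EuclideanSpace ℝ (Fin 3))‖ ^ 2))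
  have hH : Measurable H := by
    refine hG.comp (Continuous.measurable ?_)
    fun_prop
  have h1 : ∫⁻ x : EuclideanSpace ℝ (Fin 4), G (x 0, ‖x‖) = ∫⁻ p, H p := by
    rw [← hmp.lintegral_comp hH]
    refine lintegral_congr fun x => ?_
    simp only [H]
    congr 2
    rw [eq_comm, Real.sqrt_eq_iff_mul_self_eq (by positivity) (norm_nonneg _), ← sq,
      EuclideanSpace.norm_sq_eq, EuclideanSpace.norm_sq_eq]
    simp [MeasurableEquiv.piFinSuccAbove, Fin.insertNthEquiv, Fin.sum_univ_succ, Fin.tail]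
  have h2 (a : ℝ) : ∫⁻ w : Fin 3 → ℝ, H (a, w) =
      (volume : Measure (EuclideanSpace ℝ (Fin 3))).toSphere Set.univ *
        ∫⁻ ρ in Set.Ioi (0 : ℝ), ENNReal.ofReal (ρ ^ 2) * G (a, √(a ^ 2 + ρ ^ 2)) := by
    have hm : Measurable fun ρ : ℝ => G (a, √(a ^ 2 + ρ ^ 2)) := hG.comp (by fun_prop)
    have h3 := lintegral_polar (volume : Measure (EuclideanSpace ℝ (Fin 3)))
      (F := fun _ => 1) measurable_const hm
    simp only [one_mul, lintegral_one, finrank_euclideanSpace, Fintype.card_fin] at h3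
    rw [← h3]
    exact (PiLp.volume_preserving_toLp (Fin 3)).lintegral_comp
      (f := fun x : EuclideanSpace ℝ (Fin 3) => G (a, √(a ^ 2 + ‖x‖ ^ 2))) (hm.comp measurable_norm)
  rw [h1, Measure.volume_eq_prod, lintegral_prod _ hH.aemeasurable]
  simp only [h2]
  rw [lintegral_const_mul]
  have hm2 : Measurable fun p : ℝ × ℝ => ENNReal.ofReal (p.2 ^ 2) * G (p.1, √(p.1 ^ 2 + p.2 ^ 2)) :=
    (by fun_prop : Measurable fun p : ℝ × ℝ => ENNReal.ofReal (p.2 ^ 2)).mul (hG.comp (by fun_prop))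
  exact hm2.lintegral_prod_right'

/-- Put a = r cos θ, ρ = r sin θ: the weight ρ² and the Jacobian r combine to r³ sin² θ. -/
lemma lintegral_half_plane {F h : ℝ → ENNReal} (hF : Measurable F) (hh : Measurable h) :
    ∫⁻ a : ℝ, ∫⁻ ρ in Set.Ioi (0 : ℝ), ENNReal.ofReal (ρ ^ 2) *
        (F ((√(a ^ 2 + ρ ^ 2))⁻¹ * a) * h √(a ^ 2 + ρ ^ 2)) =
      (∫⁻ r in Set.Ioi (0 : ℝ), ENNReal.ofReal (r ^ 3) * h r) *
        ∫⁻ θ in Set.Ioo 0 Real.pi, ENNReal.ofReal (Real.sin θ ^ 2) * F (Real.cos θ) := by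
  -- Extension by zero to ρ ≤ 0 makes polar coordinates on the whole plane applicable.
  let Φ : ℝ × ℝ → ENNReal := fun p => (Set.Ioi (0 : ℝ)).indicator (fun ρ => ENNReal.ofReal (ρ ^ 2) *
        (F ((√(p.1 ^ 2 + ρ ^ 2))⁻¹ * p.1) * h √(p.1 ^ 2 + ρ ^ 2))) p.2
  have hΦ : Measurable Φ := by
    have : Φ = (Prod.snd ⁻¹' (Set.Ioi (0 : ℝ))).indicator (fun p : ℝ × ℝ =>
        ENNReal.ofReal (p.2 ^ 2) *
          (F ((√(p.1 ^ 2 + p.2 ^ 2))⁻¹ * p.1) * h √(p.1 ^ 2 + p.2 ^ 2))) := rfl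
    rw [this]
    refine Measurable.indicator ?_ (measurable_snd measurableSet_Ioi)
    exact (by fun_prop : Measurable fun p : ℝ × ℝ => ENNReal.ofReal (p.2 ^ 2)).mul
      ((hF.comp (by fun_prop)).mul (hh.comp (by fun_prop)))
  have h1 : ∫⁻ a : ℝ, ∫⁻ ρ in Set.Ioi (0 : ℝ), ENNReal.ofReal (ρ ^ 2) *
        (F ((√(a ^ 2 + ρ ^ 2))⁻¹ * a) * h √(a ^ 2 + ρ ^ 2)) = ∫⁻ p, Φ p := by
    rw [Measure.volume_eq_prod, lintegral_prod _ hΦ.aemeasurable]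
    refine lintegral_congr fun a => ?_
    rw [← lintegral_indicator measurableSet_Ioi]
  have hm : Measurable fun θ => ENNReal.ofReal (Real.sin θ ^ 2) * F (Real.cos θ) :=
    (by fun_prop : Measurable fun θ => ENNReal.ofReal (Real.sin θ ^ 2)).mul
      (hF.comp (by fun_prop))
  have h2 : ∫⁻ θ in Set.Ioo 0 Real.pi, ENNReal.ofReal (Real.sin θ ^ 2) * F (Real.cos θ) =
      ∫⁻ θ in Set.Ioo (-Real.pi) Real.pi, (Set.Ioo 0 Real.pi).indicator
        (fun θ => ENNReal.ofReal (Real.sin θ ^ 2) * F (Real.cos θ)) θ := by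
    rw [lintegral_indicator measurableSet_Ioo, Measure.restrict_restrict measurableSet_Ioo,
      Set.inter_eq_left.2 (Set.Ioo_subset_Ioo_left (by linarith [Real.pi_pos]))]
  rw [h1, ← lintegral_comp_polarCoord_symm, polarCoord_target, Measure.volume_eq_prod,
    ← Measure.prod_restrict, h2, ← lintegral_prod_mul]
  · rw [Measure.prod_restrict]
    refine setLIntegral_congr_fun (measurableSet_Ioi.prod measurableSet_Ioo) ?_
    rintro ⟨r, θ⟩ ⟨hr : 0 < r, hθ⟩
    have hs : √((r * Real.cos θ) ^ 2 + (r * Real.sin θ) ^ 2) = r := by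
      have : (r * Real.cos θ) ^ 2 + (r * Real.sin θ) ^ 2 = r ^ 2 := by
        linear_combination r ^ 2 * Real.sin_sq_add_cos_sq θ
      rw [this, Real.sqrt_sq hr.le]
    simp only [polarCoord_symm_apply, Φ, smul_eq_mul]
    by_cases hθ0 : 0 < θ
    · have hsin := Real.sin_pos_of_pos_of_lt_pi hθ0 hθ.2
      rw [Set.indicator_of_mem (Set.mem_Ioi.2 (mul_pos hr hsin)),
        Set.indicator_of_mem (Set.mem_Ioo.2 ⟨hθ0, hθ.2⟩), hs, ← mul_assoc r⁻¹,
        inv_mul_cancel₀ hr.ne', one_mul, mul_pow, ENNReal.ofReal_mul (by positivity), pow_succ' r 2,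
        ENNReal.ofReal_mul hr.le]
      ring
    · have hsin := Real.sin_nonpos_of_nonpos_of_neg_pi_le (not_lt.1 hθ0) hθ.1.le
      rw [Set.indicator_of_notMem, Set.indicator_of_notMem]
      · simp
      · simp [hθ0]
      · simpa using mul_nonpos_of_nonneg_of_nonpos hr.le hsin
  · exact ((by fun_prop : Measurable fun r : ℝ => ENNReal.ofReal (r ^ 3)).mul hh).aemeasurable
  · exact (hm.indicator measurableSet_Ioo).aemeasurable

/-- Integrate F(⟨e, x/‖x‖⟩) over the unit ball of ℝ⁴ in two ways: in polar coordinates, and by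
slicing after e has been moved to the first axis. The value of K is not needed; F = 1 recovers it
later. -/
lemma exists_lintegral_sphere : ∃ K : ENNReal, ∀ e : EuclideanSpace ℝ (Fin 4), ‖e‖ = 1 →
    ∀ F : ℝ → ENNReal, Measurable F →
      ∫⁻ ω, F (inner ℝ e ω.1) ∂sphereMeasure =
        K * ∫⁻ θ in Set.Ioo 0 Real.pi, ENNReal.ofReal (Real.sin θ ^ 2) * F (Real.cos θ) := by
  obtain ⟨K, hK⟩ := exists_lintegral_slice
  let h : ℝ → ENNReal := (Set.Iio 1).indicator fun _ => 1
  have hh : Measurable h := measurable_const.indicator measurableSet_Iio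
  set c := ∫⁻ r in Set.Ioi (0 : ℝ), ENNReal.ofReal (r ^ 3) * h r with hc
  set A := (volume : Measure (EuclideanSpace ℝ (Fin 4))).toSphere Set.univ with hA
  have key (e : EuclideanSpace ℝ (Fin 4)) (he : ‖e‖ = 1) (F : ℝ → ENNReal) (hF : Measurable F) :
      (∫⁻ ω, F (inner ℝ e ω.1) ∂(volume : Measure (EuclideanSpace ℝ (Fin 4))).toSphere) * c =
        K * (c * ∫⁻ θ in Set.Ioo 0 Real.pi, ENNReal.ofReal (Real.sin θ ^ 2) * F (Real.cos θ)) := by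
    have h1 := lintegral_polar (volume : Measure (EuclideanSpace ℝ (Fin 4)))
      (F := fun x => F (inner ℝ e x)) (hF.comp (by fun_prop)) hh
    simp only [finrank_euclideanSpace, Fintype.card_fin] at h1
    rw [hc, ← h1, ← lintegral_half_plane hF hh]
    have hG : Measurable fun p : ℝ × ℝ => F (p.2⁻¹ * p.1) * h p.2 :=
      (hF.comp (by fun_prop)).mul (hh.comp measurable_snd)
    rw [← hK _ hG]
    have hf : ‖e‖ = ‖(EuclideanSpace.single 0 1 : EuclideanSpace ℝ (Fin 4))‖ := by simp [he]
    -- The reflection exchanging e and the first basis vector.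
    let R := (Submodule.span ℝ {e - EuclideanSpace.single 0 1})ᗮ.reflection
    have hR : R e = EuclideanSpace.single 0 1 := Submodule.reflection_sub hf
    rw [← R.measurePreserving.lintegral_comp_emb R.toMeasurableEquiv.measurableEmbedding]
    refine lintegral_congr fun x => ?_
    have h3 : inner ℝ e (R x) = x 0 := by
      rw [← R.inner_map_map e (R x), hR, show R (R x) = x from Submodule.reflection_reflection _ x,
        EuclideanSpace.inner_single_left]
      simp
    rw [inner_smul_right, h3, R.norm_map]
  have hA0 : A ≠ 0 := by
    rw [hA, Measure.toSphere_apply_univ]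
    exact mul_ne_zero (by simp) (Metric.measure_ball_pos _ _ one_pos).ne'
  -- The volume of the ball is positive and finite, hence so is c, which can then be cancelled.
  have hcv : (volume : Measure (EuclideanSpace ℝ (Fin 4))) (Metric.ball 0 1) = A * c := by
    have h1 := lintegral_polar (volume : Measure (EuclideanSpace ℝ (Fin 4)))
      (F := fun _ => 1) measurable_const hh
    simp only [finrank_euclideanSpace, Fintype.card_fin, lintegral_one, one_mul] at h1
    rw [hc, hA, ← h1, ← lintegral_indicator_one measurableSet_ball]
    refine lintegral_congr fun x => ?_
    simp [h, Set.indicator]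
  have hc0 : c ≠ 0 := by
    rintro h0
    rw [h0, mul_zero] at hcv
    exact (Metric.measure_ball_pos _ _ one_pos).ne' hcv
  have hct : c ≠ ⊤ := by
    rintro h0
    rw [h0, ENNReal.mul_top hA0] at hcv
    exact measure_ball_lt_top.ne hcv
  refine ⟨A⁻¹ * K, fun e he F hF => ?_⟩
  have h2 := key e he F hF
  rw [mul_comm c, ← mul_assoc] at h2
  rw [ENNReal.mul_left_inj hc0 hct] at h2
  rw [sphereMeasure, lintegral_smul_measure, h2, smul_eq_mul, mul_assoc]

/-! ### Plurisubharmonicity -/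

lemma re_one_sub_sq_div {s : ℝ} (θ : ℝ) :
    ((1 - circleMap 0 1 θ ^ 2) / (1 + s * circleMap 0 1 θ)).re =
      2 * (Real.sin θ ^ 2 / (1 + s ^ 2 + 2 * s * Real.cos θ)) := by
  have hz : circleMap 0 1 θ = Real.cos θ + Real.sin θ * Complex.I := by
    simp [circleMap, Complex.exp_mul_I]
  have hn : Complex.normSq (1 + s * circleMap 0 1 θ) = 1 + s ^ 2 + 2 * s * Real.cos θ := by
    rw [hz, Complex.normSq_apply]
    simp [-Complex.ofReal_cos, -Complex.ofReal_sin]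
    linear_combination s ^ 2 * Real.sin_sq_add_cos_sq θ
  rw [Complex.div_re, hn, ← add_div, mul_div_assoc']
  congr 1
  rw [hz]
  simp [-Complex.ofReal_cos, -Complex.ofReal_sin, sq]
  linear_combination -(1 + s * Real.cos θ) * Real.sin_sq_add_cos_sq θ

/-- Twice the integrand is the real part of (1 - z²)/(1 + sz) on the unit circle. For s < 1 this
function is holomorphic on the closed disc with value 1 at 0, so its circle average is 1; θ ↦ 2π - θ
halves the interval. -/
lemma integral_sin_sq_div {s : ℝ} (h0 : 0 ≤ s) (h1 : s < 1) :
    ∫ θ in (0 : ℝ)..Real.pi, Real.sin θ ^ 2 / (1 + s ^ 2 + 2 * s * Real.cos θ) = Real.pi / 2 := by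
  set g : ℝ → ℝ := fun θ => Real.sin θ ^ 2 / (1 + s ^ 2 + 2 * s * Real.cos θ) with hg
  have hpos (θ : ℝ) : 1 + s ^ 2 + 2 * s * Real.cos θ ≠ 0 := by
    nlinarith [Real.neg_one_le_cos θ, mul_nonneg h0 (by linarith [Real.neg_one_le_cos θ] :
      0 ≤ 1 + Real.cos θ)]
  have hgc : Continuous g := by
    rw [hg]; fun_prop (disch := exact hpos _)
  let f : ℂ → ℂ := fun z => (1 - z ^ 2) / (1 + s * z)
  have hne (z : ℂ) (hz : z ∈ Metric.closedBall (0 : ℂ) 1) : 1 + s * z ≠ 0 := by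
    intro h
    have h2 : ‖(s * z : ℂ)‖ = 1 := by
      rw [eq_neg_of_add_eq_zero_right h]; simp
    rw [norm_mul, Complex.norm_real, Real.norm_of_nonneg h0] at h2
    have h3 : ‖z‖ ≤ 1 := by simpa using hz
    nlinarith [norm_nonneg z]
  have hf : DifferentiableOn ℂ f (Metric.closedBall 0 1) := by
    intro z hz
    have := hne z hz
    exact DifferentiableAt.differentiableWithinAt (by fun_prop (disch := assumption))
  have havg := DiffContOnCl.circleAverage (f := f) (c := 0) (R := 1)
    (by
      rw [abs_one]
      exact DifferentiableOn.diffContOnCl (by rwa [closure_ball _ one_ne_zero]))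
  rw [Real.circleAverage_def, inv_smul_eq_iff₀ (by positivity)] at havg
  have hfc : Continuous fun θ => f (circleMap 0 1 θ) := by
    refine hf.continuousOn.comp_continuous (by fun_prop) fun θ => ?_
    exact Metric.sphere_subset_closedBall (circleMap_mem_sphere 0 zero_le_one θ)
  have hre : ∫ θ in (0 : ℝ)..2 * Real.pi, 2 * g θ = 2 * Real.pi := by
    have h2 := Complex.reCLM.intervalIntegral_comp_comm (hfc.intervalIntegrable (μ := volume) 0 (2 * Real.pi))
    rw [havg] at h2
    simp only [Complex.reCLM_apply, f, re_one_sub_sq_div] at h2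
    simpa using h2
  rw [intervalIntegral.integral_const_mul] at hre
  have hsplit := intervalIntegral.integral_add_adjacent_intervals
    (hgc.intervalIntegrable (μ := volume) 0 Real.pi) (hgc.intervalIntegrable (μ := volume) Real.pi (2 * Real.pi))
  have hsymm : ∫ θ in Real.pi..2 * Real.pi, g θ = ∫ θ in (0 : ℝ)..Real.pi, g θ := by
    have h2 := intervalIntegral.integral_comp_sub_left g (a := 0) (b := Real.pi) (2 * Real.pi)
    rw [sub_zero, show 2 * Real.pi - Real.pi = Real.pi by ring] at h2
    rw [← h2]
    congr 1
    ext θ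
    simp [hg, Real.sin_two_pi_sub, Real.cos_two_pi_sub]
  linarith

lemma lintegral_ofReal_Ioo {g : ℝ → ℝ} (hg : Continuous g)
    (h0 : ∀ θ ∈ Set.Ioo 0 Real.pi, 0 ≤ g θ) :
    ∫⁻ θ in Set.Ioo 0 Real.pi, ENNReal.ofReal (g θ) =
      ENNReal.ofReal (∫ θ in (0 : ℝ)..Real.pi, g θ) := by
  rw [intervalIntegral.integral_of_le Real.pi_pos.le, integral_Ioc_eq_integral_Ioo,
    ofReal_integral_eq_lintegral_ofReal]
  · exact (hg.integrableOn_Icc).mono_set Set.Ioo_subset_Icc_self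
  · exact (ae_restrict_iff' measurableSet_Ioo).2 (Eventually.of_forall h0)

/-- The mean value property of ‖x‖⁻² in ℝ⁴, for spheres that may touch the pole. -/
lemma lintegral_sin_sq_mul_inv {s : ℝ} (h0 : 0 ≤ s) (h1 : s ≤ 1) :
    ∫⁻ θ in Set.Ioo 0 Real.pi, ENNReal.ofReal (Real.sin θ ^ 2) *
      (ENNReal.ofReal (1 + s ^ 2 + 2 * s * Real.cos θ))⁻¹ = ENNReal.ofReal (Real.pi / 2) := by
  have hcos (θ : ℝ) (hθ : θ ∈ Set.Ioo 0 Real.pi) : 0 < 1 + Real.cos θ := by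
    have := Real.cos_lt_cos_of_nonneg_of_le_pi hθ.1.le le_rfl hθ.2
    rw [Real.cos_pi] at this
    linarith
  have hpos (θ : ℝ) (hθ : θ ∈ Set.Ioo 0 Real.pi) : 0 < 1 + s ^ 2 + 2 * s * Real.cos θ := by
    rcases h0.eq_or_lt with rfl | hs
    · norm_num
    · nlinarith [mul_pos hs (hcos θ hθ), sq_nonneg (1 - s)]
  have he : ∫⁻ θ in Set.Ioo 0 Real.pi, ENNReal.ofReal (Real.sin θ ^ 2) *
      (ENNReal.ofReal (1 + s ^ 2 + 2 * s * Real.cos θ))⁻¹ = ∫⁻ θ in Set.Ioo 0 Real.pi,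
        ENNReal.ofReal (Real.sin θ ^ 2 / (1 + s ^ 2 + 2 * s * Real.cos θ)) := by
    refine setLIntegral_congr_fun measurableSet_Ioo fun θ hθ => ?_
    rw [ENNReal.ofReal_div_of_pos (hpos θ hθ), div_eq_mul_inv]
  rw [he]
  rcases h1.lt_or_eq with h1 | rfl
  · have hne (θ : ℝ) : 1 + s ^ 2 + 2 * s * Real.cos θ ≠ 0 := by
      nlinarith [Real.neg_one_le_cos θ, mul_nonneg h0 (by linarith [Real.neg_one_le_cos θ] :
        0 ≤ 1 + Real.cos θ)]
    rw [lintegral_ofReal_Ioo (by fun_prop (disch := exact hne _))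
      (fun θ hθ => by have := hpos θ hθ; positivity), integral_sin_sq_div h0 h1]
  -- At s = 1 the pole lies on the sphere, but sin² θ = (1 - cos θ)(1 + cos θ) removes it.
  · have he2 : ∫⁻ θ in Set.Ioo 0 Real.pi,
        ENNReal.ofReal (Real.sin θ ^ 2 / (1 + 1 ^ 2 + 2 * 1 * Real.cos θ)) =
        ∫⁻ θ in Set.Ioo 0 Real.pi, ENNReal.ofReal ((1 - Real.cos θ) / 2) := by
      refine setLIntegral_congr_fun measurableSet_Ioo fun θ hθ => ?_
      have h2 := (hpos θ hθ).ne'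
      congr 1
      rw [div_eq_div_iff h2 two_ne_zero]
      linear_combination 2 * Real.sin_sq_add_cos_sq θ
    rw [he2, lintegral_ofReal_Ioo (by fun_prop) (fun θ _ => by linarith [Real.cos_le_one θ])]
    congr 1
    rw [intervalIntegral.integral_div, intervalIntegral.integral_sub (by simp)
      (Real.continuous_cos.intervalIntegrable _ _)]
    simp

lemma sphereMeasure_univ : sphereMeasure Set.univ = 1 := by
  rw [sphereMeasure, Measure.smul_apply, smul_eq_mul]
  refine ENNReal.inv_mul_cancel ?_ ?_ <;> rw [Measure.toSphere_apply_univ]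
  · exact mul_ne_zero (by simp) (Metric.measure_ball_pos _ _ one_pos).ne'
  · exact ENNReal.mul_ne_top (by simp) measure_ball_lt_top.ne

lemma lintegral_sphere_inv_le {P Q : ℝ} (hP : 0 < P) (hQ : 0 ≤ Q)
    {e : EuclideanSpace ℝ (Fin 4)} (he : ‖e‖ ^ 2 ≤ P * Q) :
    ∫⁻ ω, (ENNReal.ofReal (P + Q + 2 * inner ℝ e ω.1))⁻¹ ∂sphereMeasure ≤
      (ENNReal.ofReal P)⁻¹ := by
  obtain ⟨K, hK⟩ := exists_lintegral_sphere
  set m := ‖e‖ with hm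
  have hm0 : 0 ≤ m := norm_nonneg e
  obtain ⟨e', he', hee⟩ : ∃ e' : EuclideanSpace ℝ (Fin 4), ‖e'‖ = 1 ∧ e = m • e' := by
    by_cases h : e = 0
    · exact ⟨EuclideanSpace.single 0 1, by simp, by simp [hm, h]⟩
    · have hne : ‖e‖ ≠ 0 := norm_ne_zero_iff.2 h
      exact ⟨m⁻¹ • e, by rw [norm_smul, hm, norm_inv, norm_norm, inv_mul_cancel₀ hne], by
        rw [smul_smul, mul_inv_cancel₀ hne, one_smul]⟩
  have hdisc : (P - Q) ^ 2 ≤ (P + Q) ^ 2 - 4 * m ^ 2 := by nlinarith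
  -- The larger root of κ² - (P+Q)κ + m² = 0, so that P + Q + 2mx = κ(1 + s² + 2sx) with s = m/κ.
  -- The discriminant is at least (P-Q)², whence κ ≥ P and κ ≥ Q.
  set κ := (P + Q + √((P + Q) ^ 2 - 4 * m ^ 2)) / 2 with hκ
  have hsqrt : |P - Q| ≤ √((P + Q) ^ 2 - 4 * m ^ 2) := by
    rw [← Real.sqrt_sq_eq_abs]; exact Real.sqrt_le_sqrt hdisc
  have hκP : P ≤ κ := by rw [hκ]; linarith [le_abs_self (P - Q)]
  have hκQ : Q ≤ κ := by rw [hκ]; linarith [neg_abs_le (P - Q)]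
  have hκ0 : 0 < κ := hP.trans_le hκP
  have hquad : κ ^ 2 + m ^ 2 = (P + Q) * κ := by
    have := Real.sq_sqrt ((sq_nonneg (P - Q)).trans hdisc)
    rw [hκ]; nlinarith
  have hmκ : m ≤ κ := by
    refine le_of_sq_le_sq ?_ hκ0.le
    calc m ^ 2 ≤ P * Q := he
      _ ≤ κ * κ := by gcongr
      _ = κ ^ 2 := (sq κ).symm
  set s := m / κ with hs
  have hs0 : 0 ≤ s := by positivity
  have hs1 : s ≤ 1 := (div_le_one hκ0).2 hmκ
  have hrew (x : ℝ) : P + Q + 2 * (m * x) = κ * (1 + s ^ 2 + 2 * s * x) := by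
    rw [hs]; field_simp; linear_combination -hquad
  have hK1 : K * ENNReal.ofReal (Real.pi / 2) = 1 := by
    have h1 := hK e' he' (fun _ => 1) measurable_const
    rw [lintegral_one, sphereMeasure_univ] at h1
    rw [h1, ← lintegral_sin_sq_mul_inv le_rfl zero_le_one]
    simp
  have hF : Measurable fun x : ℝ => (ENNReal.ofReal (1 + s ^ 2 + 2 * s * x))⁻¹ := by fun_prop
  have hκt : ENNReal.ofReal κ ≠ ⊤ := ENNReal.ofReal_ne_top
  have hκn : ENNReal.ofReal κ ≠ 0 := by simpa using hκ0
  calc ∫⁻ ω, (ENNReal.ofReal (P + Q + 2 * inner ℝ e ω.1))⁻¹ ∂sphereMeasure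
      = ∫⁻ ω, (ENNReal.ofReal κ)⁻¹ *
          (ENNReal.ofReal (1 + s ^ 2 + 2 * s * inner ℝ e' ω.1))⁻¹ ∂sphereMeasure := by
        refine lintegral_congr fun ω => ?_
        rw [hee, real_inner_smul_left, hrew, ENNReal.ofReal_mul hκ0.le,
          ENNReal.mul_inv (Or.inl hκn) (Or.inl hκt)]
    _ = (ENNReal.ofReal κ)⁻¹ * (K * ENNReal.ofReal (Real.pi / 2)) := by
        rw [lintegral_const_mul' _ _ (ENNReal.inv_ne_top.2 hκn), hK e' he' _ hF,
          lintegral_sin_sq_mul_inv hs0 hs1]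
    _ ≤ (ENNReal.ofReal P)⁻¹ := by
        rw [hK1, mul_one, ENNReal.inv_le_inv]
        exact ENNReal.ofReal_le_ofReal hκP

/-! ### The function on right quaternionic lines. -/

lemma negInvNormSq_eq {n : ℕ} (q : QSpace n) :
    negInvNormSq n q = -(((ENNReal.ofReal (‖q‖ ^ 2))⁻¹ : ENNReal) : EReal) := by
  unfold negInvNormSq
  split_ifs with h
  · simp [h]
  · have hq : 0 < ‖q‖ ^ 2 := by have := norm_pos_iff.2 h; positivity
    rw [← ENNReal.ofReal_inv_of_pos hq, EReal.coe_ennreal_ofReal, max_eq_left (by positivity),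
      ← EReal.coe_neg]
    congr 1
    rw [neg_div, one_div]

/-- Inversion is continuous on [0, ∞] with 0⁻¹ = ∞, so the origin needs no separate treatment. -/
lemma continuous_negInvNormSq (n : ℕ) : Continuous (negInvNormSq n) := by
  rw [funext negInvNormSq_eq]
  exact continuous_neg.comp (continuous_coe_ennreal_ereal.comp
    (continuous_inv.comp (ENNReal.continuous_ofReal.comp (by fun_prop))))

lemma negInvNormSq_ne_top {n : ℕ} (q : QSpace n) : negInvNormSq n q ≠ ⊤ := by
  unfold negInvNormSq
  split_ifs <;> simp

lemma norm_ofQuat_sq {n : ℕ} (p : Fin n → ℍ[ℝ]) : ‖ofQuat p‖ ^ 2 = ∑ l, ‖p l‖ ^ 2 := by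
  rw [EuclideanSpace.norm_sq_eq, Fintype.sum_prod_type]
  refine Finset.sum_congr rfl fun l _ => ?_
  rw [← Quaternion.linearIsometryEquivTuple.norm_map (p l), EuclideanSpace.norm_sq_eq]
  rfl

lemma continuous_ofQuat_line {n : ℕ} (a b : Fin n → ℍ[ℝ]) :
    Continuous fun t : ℍ[ℝ] => ofQuat fun l => a l + b l * t := by
  unfold ofQuat
  refine (PiLp.continuous_toLp 2 _).comp (continuous_pi fun p => ?_)
  have h : Continuous fun t : ℍ[ℝ] => Quaternion.linearIsometryEquivTuple (a p.1 + b p.1 * t) :=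
    Quaternion.linearIsometryEquivTuple.continuous.comp (by fun_prop)
  exact (EuclideanSpace.proj p.2 : EuclideanSpace ℝ (Fin 4) →L[ℝ] ℝ).continuous.comp h

/-- Left multiplication by b has adjoint left multiplication by its conjugate; this gathers the
cross terms on a line into one inner product. -/
lemma inner_star_mul (b p t : ℍ[ℝ]) : inner ℝ (star b * p) t = inner ℝ p (b * t) := by
  simp only [Quaternion.inner_def, star_mul, ← mul_assoc]
  simp only [Quaternion.re_mul, Quaternion.imI_mul, Quaternion.imJ_mul, Quaternion.imK_mul]
  ring

lemma exists_norm_line_sq {n : ℕ} (p b : Fin n → ℍ[ℝ]) (r : ℝ) :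
    ∃ e : EuclideanSpace ℝ (Fin 4), ‖e‖ ^ 2 ≤ (∑ l, ‖p l‖ ^ 2) * (r ^ 2 * ∑ l, ‖b l‖ ^ 2) ∧
      ∀ ω : EuclideanSpace ℝ (Fin 4), ‖ω‖ = 1 →
        ∑ l, ‖p l + b l * (r • Quaternion.linearIsometryEquivTuple.symm ω)‖ ^ 2 =
          ∑ l, ‖p l‖ ^ 2 + r ^ 2 * ∑ l, ‖b l‖ ^ 2 + 2 * inner ℝ e ω := by
  -- The vector r ∑ b̄_l p_l carries the cross terms; its norm is bounded by Cauchy–Schwarz.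
  refine ⟨r • ∑ l, Quaternion.linearIsometryEquivTuple (star (b l) * p l), ?_, fun ω hω => ?_⟩
  · rw [norm_smul, mul_pow, Real.norm_eq_abs, sq_abs]
    have h1 : ‖∑ l, Quaternion.linearIsometryEquivTuple (star (b l) * p l)‖ ≤
        ∑ l, ‖p l‖ * ‖b l‖ := by
      refine norm_sum_le_of_le _ fun l _ => ?_
      rw [LinearIsometryEquiv.norm_map, norm_mul, norm_star, mul_comm]
    calc _ ≤ r ^ 2 * (∑ l, ‖p l‖ * ‖b l‖) ^ 2 := by gcongr
      _ ≤ r ^ 2 * ((∑ l, ‖p l‖ ^ 2) * ∑ l, ‖b l‖ ^ 2) := by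
        gcongr; exact Finset.sum_mul_sq_le_sq_mul_sq _ _ _
      _ = _ := by ring
  · set τ := Quaternion.linearIsometryEquivTuple.symm ω with hτ
    have hτ1 : ‖τ‖ = 1 := by rw [hτ, LinearIsometryEquiv.norm_map, hω]
    have hω' : ω = Quaternion.linearIsometryEquivTuple τ :=
      (LinearIsometryEquiv.apply_symm_apply _ ω).symm
    rw [real_inner_smul_left, sum_inner, hω']
    simp only [LinearIsometryEquiv.inner_map_map, inner_star_mul]
    rw [Finset.mul_sum, Finset.mul_sum, Finset.mul_sum, ← Finset.sum_add_distrib,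
      ← Finset.sum_add_distrib]
    refine Finset.sum_congr rfl fun l _ => ?_
    rw [norm_add_sq_real, mul_smul_comm, real_inner_smul_right, norm_smul, norm_mul, hτ1,
      mul_pow, Real.norm_eq_abs, sq_abs]
    ring

lemma isSubharmonic_negInvNormSq_line {n : ℕ} (a b : Fin n → ℍ[ℝ]) :
    IsSubharmonic fun t => negInvNormSq n (ofQuat fun l => a l + b l * t) := by
  refine ⟨((continuous_negInvNormSq n).comp (continuous_ofQuat_line a b)).upperSemicontinuous,
    fun _ => negInvNormSq_ne_top _, fun c r _ => ?_⟩
  unfold sphereMean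
  simp only [negInvNormSq_eq, norm_ofQuat_sq, neg_neg, EReal.toENNReal_coe]
  -- The function is nonpositive, so its positive part drops out of `sphereMean`.
  have h0 (x : ENNReal) : (-(x : EReal)).toENNReal = 0 :=
    EReal.toENNReal_of_nonpos (by simpa using EReal.coe_ennreal_nonneg x)
  simp only [h0, lintegral_zero, EReal.coe_ennreal_zero, zero_sub]
  rw [EReal.neg_le_neg_iff, EReal.coe_ennreal_le_coe_ennreal_iff]
  set p : Fin n → ℍ[ℝ] := fun l => a l + b l * c with hp
  have hP : 0 ≤ ∑ l, ‖p l‖ ^ 2 := by positivity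
  -- If P = 0 the centre is the origin, where the value is -∞ and the inequality is trivial.
  rcases hP.eq_or_lt with h | h
  · rw [← h]; simp
  obtain ⟨e, he, hN⟩ := exists_norm_line_sq p b r
  refine le_trans (le_of_eq (lintegral_congr fun ω => ?_))
    (lintegral_sphere_inv_le h (by positivity) he)
  rw [← hN ω.1 (by simp)]
  simp only [hp, mul_add, add_assoc]

lemma isPSH_negInvNormSq (n : ℕ) : IsPSH (negInvNormSq n) :=
  ⟨(continuous_negInvNormSq n).upperSemicontinuous, negInvNormSq_ne_top,
    fun a b _ => isSubharmonic_negInvNormSq_line a b⟩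

end QuaternionicMA

end

theorem proposition4p2 (n : ℕ) (hn : 0 < n) :
    QuaternionicMA.IsPSH (QuaternionicMA.negInvNormSq n) ∧
    ∀ μ : MeasureTheory.Measure (QuaternionicMA.QSpace n),
      QuaternionicMA.IsMongeAmpereMeasure (QuaternionicMA.negInvNormSq n) μ ↔
        μ = ENNReal.ofReal
            (8 ^ n * (n.factorial : ℝ) * Real.pi ^ (2 * n) / ((2 * n).factorial : ℝ)) •
          MeasureTheory.Measure.dirac 0 :=
  ⟨QuaternionicMA.isPSH_negInvNormSq n, QuaternionicMA.isMongeAmpereMeasure_iff hn⟩
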